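/- Let $K$ be a field and $X$ a finite, linearly ordered alphabet. Order words lexicographically (a proper left factor of a word is smaller than the word). A nonempty word $w$ is a Lyndon word if $w<ba$ for every factorization $w=ab$ into nonempty words. Let $W$ be an antichain (for the subword order) of Lyndon words, of any cardinality, let $(W)$ be the two-sided ideal it generates in the free algebra $K\langle X\rangle$, and let $A=K\langle X\rangle/(W)=\bigoplus_n A_n$, graded by length of words. A word is normal if none of its subwords lies in $W$; let $\mathfrak N$ be the set of normal words (the empty word included) and $N$ the set of normal Lyndon words ("Lyndon atoms"). (1) $\mathfrak N$ is exactly the set of words $l_1^{k_1}l_2^{k_2}\cdots l_s^{k_s}$ with $s\ge 0$, $l_1>l_2>\cdots>l_s$ in $N$ and $k_i\ge 0$, and (the image of) $\mathfrak N$ is a $K$-basis of $A$. (2) The following are equivalent: (i) $N$ is finite; (ii) $A$ has polynomial growth, i.e. there are real numbers $d$ and $C>0$ with $\dim_K A_n\le Cn^d$ for all $n\ge 1$; (iii) $A$ is a PI algebra, i.e. some nonzero noncommutative polynomial over $K$ vanishes under all substitutions of elements of $A$; (iv) $A$ embeds, as a $K$-algebra, in a matrix ring $M_n(L)$ over some extension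 field $L$ of $K$; (iv$'$) $A$ embeds, as a $K$-algebra, in a matrix ring $M_n(C)$ over some commutative $K$-algebra $C$. (3) If these conditions hold, write $N=\{l_1>l_2>\cdots>l_d\}$ with $d=|N|$. Then $\mathfrak N=\{l_1^{\alpha_1}\cdots l_d^{\alpha_d}\mid \alpha_i\ge 0\}$, the classes of the words $l_1^{\alpha_1}\cdots l_d^{\alpha_d}$, indexed by $\alpha\in\mathbb Z_{\ge 0}^d$, form a $K$-basis of $A$, the Gelfand-Kirillov dimension $\sup_V\limsup_n \log\dim_K(V^0+V^1+\cdots+V^n)/\log n$ of $A$ ($V$ running over the finite-dimensional subspaces of $A$) equals $d$, and the Hilbert series of $A$ is \[ H_A(t)=\sum_{n\ge 0}(\dim_K A_n)\,t^n=\prod_{i=1}^d\frac{1}{1-t^{|l_i|}}. \] -/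

import Mathlib

/-! ### Words

A word in the alphabet `X` is a `List X`. For a linearly ordered alphabet, Mathlib's order on
`List X` is the lexicographic order in which a proper left factor is smaller than the whole word.
`u <:+: w` says that `u` is a (contiguous) subword of `w`. -/

/-- A Lyndon word: a nonempty word that is strictly smaller than each of its proper rotations. -/
def IsLyndon {X : Type*} [LinearOrder X] (w : List X) : Prop :=
  w ≠ [] ∧ ∀ a b : List X, a ≠ [] → b ≠ [] → w = a ++ b → w < b ++ a

/-- The words (the empty one included) that contain no element of `W` as a subword. -/
def normalWords {X : Type*} (W : Set (List X)) : Set (List X) :=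
  {w | ∀ u ∈ W, ¬ u <:+: w}

/-- The Lyndon atoms: the `W`-normal Lyndon words. -/
def lyndonAtoms {X : Type*} [LinearOrder X] (W : Set (List X)) : Set (List X) :=
  {w | IsLyndon w ∧ w ∈ normalWords W}

/-- The word `l₁ ^ k₁ * ⋯ * lₛ ^ kₛ` (concatenation of words). -/
def powProd {X : Type*} {s : ℕ} (l : Fin s → List X) (k : Fin s → ℕ) : List X :=
  (List.ofFn fun i => (List.replicate (k i) (l i)).flatten).flatten

/-! ### Monomial algebras -/

/-- The monomial of the free algebra `K⟨X⟩` given by a word. -/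
noncomputable def monomialOfWord (K : Type*) [Field K] {X : Type*} (w : List X) :
    FreeAlgebra K X :=
  (w.map (FreeAlgebra.ι K)).prod

/-- The monomial algebra `K⟨X⟩ / (W)`, where `(W)` is the two-sided ideal generated by `W`. -/
abbrev MonomialAlgebra (K : Type*) [Field K] {X : Type*} (W : Set (List X)) : Type _ :=
  (TwoSidedIdeal.span (monomialOfWord K '' W)).ringCon.Quotient

/-- The class of a word in `K⟨X⟩ / (W)`. -/
noncomputable def wordClass (K : Type*) [Field K] {X : Type*} (W : Set (List X)) (w : List X) :
    MonomialAlgebra K W :=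
  (TwoSidedIdeal.span (monomialOfWord K '' W)).ringCon.mkₐ (α := K) (monomialOfWord K w)

/-- The homogeneous component of degree `n` of `K⟨X⟩ / (W)` for the grading by length of words. -/
noncomputable def component (K : Type*) [Field K] {X : Type*} (W : Set (List X)) (n : ℕ) :
    Submodule K (MonomialAlgebra K W) :=
  Submodule.span K (wordClass K W '' {w | w.length = n})

/-- Over a finite alphabet the components are finite-dimensional, so that `Module.finrank` is
their true dimension. -/
instance component_finite (K : Type*) [Field K] {X : Type*} [Finite X] (W : Set (List X)) (n : ℕ) :
    Module.Finite K (component K W n) :=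
  Module.Finite.span_of_finite K ((List.finite_length_eq X n).image _)

/-! ### Growth -/

/-- Polynomial growth of a graded algebra with components `c n`: `dim c n ≤ C * n ^ d`. -/
def HasPolynomialGrowth {K A : Type*} [Field K] [Ring A] [Algebra K A]
    (c : ℕ → Submodule K A) : Prop :=
  ∃ d C : ℝ, 0 < C ∧ ∀ n : ℕ, 1 ≤ n → (Module.finrank K (c n) : ℝ) ≤ C * (n : ℝ) ^ d

/-- The Hilbert series `∑ₙ (dim c n) tⁿ` of a graded algebra with components `c n`. -/
noncomputable def hilbertSeries {K A : Type*} [Field K] [Ring A] [Algebra K A]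
    (c : ℕ → Submodule K A) : PowerSeries ℚ :=
  PowerSeries.mk fun n => (Module.finrank K (c n) : ℚ)

/-- The Gelfand-Kirillov dimension: the supremum over all finite-dimensional subspaces `V` of
`limsup_n log (dim (V ^ 0 + V ^ 1 + ⋯ + V ^ n)) / log n`. -/
noncomputable def gkDim (K A : Type*) [Field K] [Ring A] [Algebra K A] : EReal :=
  ⨆ (V : Submodule K A) (_ : V.FG),
    Filter.limsup
      (fun n : ℕ =>
        ((Real.log (Module.finrank K (⨆ i : Fin (n + 1), V ^ (i : ℕ) : Submodule K A)) /
          Real.log n : ℝ) : EReal))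
      Filter.atTop

/-! ### Polynomial identities and matrix representations -/

/-- A PI algebra: some nonzero noncommutative polynomial over `K` vanishes on `A`. -/
def IsPIAlgebra (K A : Type*) [Field K] [Ring A] [Algebra K A] : Prop :=
  ∃ f : FreeAlgebra K ℕ, f ≠ 0 ∧ ∀ g : ℕ → A, FreeAlgebra.lift K g f = 0

/-- `A` embeds, as a `K`-algebra, in a matrix ring over an extension field of `K`. -/
def EmbedsInMatrixOverField.{u, v} (K : Type u) (A : Type v) [Field K] [Ring A] [Algebra K A] :
    Prop :=
  ∃ (L : Type u) (_ : Field L) (_ : Algebra K L) (n : ℕ) (φ : A →ₐ[K] Matrix (Fin n) (Fin n) L),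
    Function.Injective φ

/-- `A` embeds, as a `K`-algebra, in a matrix ring over a commutative `K`-algebra. -/
def EmbedsInMatrixOverCommRing.{u, v} (K : Type u) (A : Type v) [Field K] [Ring A] [Algebra K A] :
    Prop :=
  ∃ (C : Type u) (_ : CommRing C) (_ : Algebra K C) (n : ℕ)
    (φ : A →ₐ[K] Matrix (Fin n) (Fin n) C), Function.Injective φ

/-! ### Lexicographic order on words -/

/-! Every word is uniquely a nonincreasing product of Lyndon words (`flatten_lyndonFactors`,
`IsLyndonChain.eq_of_flatten_eq`), and a Lyndon subword of such a product lies inside one factor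
(`IsLyndonChain.exists_infix`). Since `W` consists of Lyndon words, a word is normal exactly when
all its Lyndon factors are atoms. Normal words are independent in the quotient because the letters
act on the span of all words by prepending, with nonnormal results replaced by zero
(`linearIndependent_wordClass`).

Counting normal words is therefore counting exponent vectors. With `d` atoms this yields the Hilbert
series, growth of degree `d` and the Gelfand-Kirillov dimension; with infinitely many, finite sets
of atoms already force growth of every degree.

A polynomial identity also forces finiteness (`finite_of_isPIAlgebra`). Let `m₀` be a longest
monomial of the identity and substitute atoms `l₁ > l₂ > ⋯` at its positions. A product of Lyndon
words with no more factors than `l₁ l₂ ⋯` can equal that word only by being the same product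
(`IsLyndonChain.eq_of_length_le`), so the coefficient of `m₀` survives.

If there are finitely many atoms, forbidden words have bounded length too (`exists_length_bound`),
and a bounded initial window of a word suffices both to detect forbidden words and to see how
prepending a letter changes the Lyndon factorization. Letters become matrices indexed by windows,
whose entries are ratios of monomials recording the change of exponents
(`letterMatrix_prod_mulVec_nil`); distinct normal words give distinct monomials, so the
representation is faithful. Matrix rings in turn satisfy a standard identity. -/

theorem List.lt_append_of_ne_nil {X : Type*} [LinearOrder X] (a : List X) {b : List X}
    (hb : b ≠ []) : a < a ++ b := by
  induction a with
  | nil => cases b with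
    | nil => exact absurd rfl hb
    | cons x b => exact List.nil_lt_cons _ _
  | cons x a ih => exact List.cons_lt_cons_iff.2 (Or.inr ⟨rfl, ih⟩)

theorem List.le_append {X : Type*} [LinearOrder X] (a b : List X) : a ≤ a ++ b := by
  by_cases hb : b = []
  · simp [hb]
  · exact (List.lt_append_of_ne_nil a hb).le

theorem List.le_of_isPrefix {X : Type*} [LinearOrder X] {a b : List X} (h : a <+: b) : a ≤ b := by
  obtain ⟨c, rfl⟩ := h
  exact List.le_append a c

theorem List.append_lt_append_left_iff {X : Type*} [LinearOrder X] (c a b : List X) :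
    c ++ a < c ++ b ↔ a < b := by
  induction c with
  | nil => simp
  | cons x c ih => simp [ih]

/-- The two words differ at a position inside both, and that position decides the comparison
whatever follows. -/
theorem List.append_lt_append_of_not_isPrefix {X : Type*} [LinearOrder X] {a b : List X}
    (h : a < b) (hp : ¬ a <+: b) (c d : List X) : a ++ c < b ++ d := by
  induction a generalizing b with
  | nil => exact absurd (List.nil_prefix) hp
  | cons x a ih =>
    cases b with
    | nil => exact absurd h (List.not_lt_nil _)
    | cons y b =>
      rw [List.cons_append, List.cons_append, List.cons_lt_cons_iff]
      rcases List.cons_lt_cons_iff.1 h with h₁ | ⟨rfl, h₁⟩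
      · exact Or.inl h₁
      · exact Or.inr ⟨rfl, ih h₁ fun h' => hp ((List.prefix_cons_inj _).2 h')⟩

/-! ### Lyndon words -/

/-- A Lyndon word is smaller than each of its proper nonempty suffixes. -/
theorem IsLyndon.lt_suffix {X : Type*} [LinearOrder X] {a b : List X} (h : IsLyndon (a ++ b))
    (ha : a ≠ []) (hb : b ≠ []) : a ++ b < b := by
  by_contra hlt
  have hne : b ≠ a ++ b := fun h' => ha (List.append_left_eq_self.1 h'.symm)
  have hba : b < a ++ b := lt_of_le_of_ne (not_lt.1 hlt) hne
  have hrot : a ++ b < b ++ a := h.2 a b ha hb rfl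
  -- If `ab = bc`, cancelling `b` in `ab < ba` gives `c < a` with equal lengths, so the rotation
  -- `cb` of `bc` is smaller than it. Otherwise `b` and `ab` differ inside `b`, so `ba < ab`.
  by_cases hp : b <+: a ++ b
  · obtain ⟨c, hc⟩ := hp
    have hlen : c.length = a.length := by
      have := congrArg List.length hc
      simp only [List.length_append] at this
      omega
    have hc0 : c ≠ [] := by
      rintro rfl
      exact ha (List.length_eq_zero_iff.1 hlen.symm)
    have hca : c < a := by
      rw [← hc] at hrot
      exact (List.append_lt_append_left_iff b c a).1 hrot
    have h1 : c ++ b < a ++ b :=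
      List.append_lt_append_of_not_isPrefix hca
        (fun h' => hca.ne (h'.eq_of_length hlen)) b b
    exact absurd (h.2 b c hb hc0 hc.symm) h1.not_gt
  · have := List.append_lt_append_of_not_isPrefix hba hp a []
    rw [List.append_nil] at this
    exact absurd hrot this.not_gt

theorem IsLyndon.le_suffix {X : Type*} [LinearOrder X] {w b : List X} (h : IsLyndon w)
    (hb : b ≠ []) (hs : b <:+ w) : w ≤ b := by
  obtain ⟨a, rfl⟩ := hs
  by_cases ha : a = []
  · simp [ha]
  · exact (h.lt_suffix ha hb).le

theorem isLyndon_of_lt_suffix {X : Type*} [LinearOrder X] {w : List X} (hw : w ≠ [])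
    (h : ∀ a b : List X, a ≠ [] → b ≠ [] → w = a ++ b → w < b) : IsLyndon w :=
  ⟨hw, fun a b ha hb hab => (h a b ha hb hab).trans_le (List.le_append b a)⟩

theorem isLyndon_singleton {X : Type*} [LinearOrder X] (x : X) : IsLyndon [x] := by
  refine isLyndon_of_lt_suffix (by simp) fun a b ha hb h => ?_
  have := congrArg List.length h
  have h1 := List.length_pos_of_ne_nil ha
  have h2 := List.length_pos_of_ne_nil hb
  simp only [List.length_append, List.length_singleton] at this
  omega

/-- The key is `l ++ m < m`, which for `m = lc` amounts to `m < c`. A proper suffix is then either a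
suffix of `m`, hence at least `m`, or starts with a proper suffix of `l`, which beats `l` at a
letter inside both. -/
theorem IsLyndon.append {X : Type*} [LinearOrder X] {l m : List X} (hl : IsLyndon l)
    (hm : IsLyndon m) (hlm : l < m) : IsLyndon (l ++ m) := by
  have key : l ++ m < m := by
    by_cases hp : l <+: m
    · obtain ⟨c, rfl⟩ := hp
      have hc : c ≠ [] := by
        rintro rfl
        simp at hlm
      exact (List.append_lt_append_left_iff l _ _).2 (hm.lt_suffix hl.1 hc)
    · simpa using List.append_lt_append_of_not_isPrefix hlm hp m []
  refine isLyndon_of_lt_suffix (by simp [hl.1]) fun a b ha hb hab => ?_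
  rcases List.append_eq_append_iff.1 hab with ⟨s, rfl, rfl⟩ | ⟨s, rfl, rfl⟩
  · by_cases hs : s = []
    · subst hs
      simpa using key
    · exact key.trans (hm.lt_suffix hs hb)
  · by_cases hs : s = []
    · subst hs
      simpa using key
    · have h1 := hl.lt_suffix ha hs
      refine List.append_lt_append_of_not_isPrefix h1 (fun h' => ?_) m m
      have := h'.length_le
      have h2 := List.length_pos_of_ne_nil ha
      simp only [List.length_append] at this
      omega

/-! ### Nonincreasing products of Lyndon words -/

/-- A nonincreasing list of Lyndon words. -/
structure IsLyndonChain {X : Type*} [LinearOrder X] (L : List (List X)) : Prop where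
  isLyndon : ∀ l ∈ L, IsLyndon l
  pairwise : L.Pairwise fun a b => b ≤ a

theorem isLyndonChain_nil {X : Type*} [LinearOrder X] :
    IsLyndonChain ([] : List (List X)) := ⟨by simp, List.Pairwise.nil⟩

theorem IsLyndonChain.head {X : Type*} [LinearOrder X] {m : List X} {L : List (List X)}
    (h : IsLyndonChain (m :: L)) : IsLyndon m := h.isLyndon m List.mem_cons_self

theorem IsLyndonChain.tail {X : Type*} [LinearOrder X] {m : List X} {L : List (List X)}
    (h : IsLyndonChain (m :: L)) : IsLyndonChain L :=
  ⟨fun l hl => h.isLyndon l (List.mem_cons_of_mem _ hl), (List.pairwise_cons.1 h.pairwise).2⟩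

theorem IsLyndonChain.le_head {X : Type*} [LinearOrder X] {m : List X} {L : List (List X)}
    (h : IsLyndonChain (m :: L)) {l : List X} (hl : l ∈ L) : l ≤ m :=
  (List.pairwise_cons.1 h.pairwise).1 l hl

theorem IsLyndonChain.cons {X : Type*} [LinearOrder X] {m : List X} {L : List (List X)}
    (h : IsLyndonChain L) (hm : IsLyndon m) (hle : ∀ l ∈ L, l ≤ m) : IsLyndonChain (m :: L) :=
  ⟨by simpa [hm] using h.isLyndon, List.pairwise_cons.2 ⟨hle, h.pairwise⟩⟩

theorem IsLyndonChain.sublist {X : Type*} [LinearOrder X] {L L' : List (List X)}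
    (h : IsLyndonChain L) (hs : L'.Sublist L) : IsLyndonChain L' :=
  ⟨fun l hl => h.isLyndon l (hs.subset hl), h.pairwise.sublist hs⟩

/-- A nonempty prefix of a product of words has a nonempty suffix that is a prefix of a factor. -/
theorem List.exists_suffix_prefix_of_prefix_flatten {X : Type*} {L : List (List X)} {b : List X}
    (hb : b ≠ []) (h : b <+: L.flatten) : ∃ c, c ≠ [] ∧ c <:+ b ∧ ∃ l ∈ L, c <+: l := by
  induction L generalizing b with
  | nil => exact absurd (List.prefix_nil.1 h) hb
  | cons m L ih =>
    obtain ⟨r, hr⟩ := h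
    rw [List.flatten_cons] at hr
    rcases List.append_eq_append_iff.1 hr with ⟨s, hm, -⟩ | ⟨s, hm, hs⟩
    · exact ⟨b, hb, List.suffix_rfl, m, List.mem_cons_self, ⟨s, hm.symm⟩⟩
    · by_cases hs0 : s = []
      · subst hs0
        exact ⟨b, hb, List.suffix_rfl, m, List.mem_cons_self, ⟨[], by simpa using hm⟩⟩
      · obtain ⟨c, hc, hcs, l, hl, hcl⟩ := ih hs0 ⟨r, hs.symm⟩
        exact ⟨c, hc, hcs.trans ⟨m, hm.symm⟩, l, List.mem_cons_of_mem _ hl, hcl⟩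

/-- No Lyndon word starts in the first factor of a chain with a nonempty suffix of it
and continues in the following factors. -/
theorem IsLyndonChain.not_isLyndon_append {X : Type*} [LinearOrder X] {m : List X}
    {L : List (List X)} (h : IsLyndonChain (m :: L)) {a b : List X} (ha : a ≠ []) (hb : b ≠ [])
    (ham : a <:+ m) (hbL : b <+: L.flatten) : ¬ IsLyndon (a ++ b) := by
  intro hab
  obtain ⟨c, hc, ⟨b', rfl⟩, l, hl, hcl⟩ := List.exists_suffix_prefix_of_prefix_flatten hb hbL
  -- The contradiction is the cycle `c ≤ l ≤ m ≤ a ≤ ab < c`, the last step because `c` is a proper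
  -- suffix of the Lyndon word `ab`.
  have h1 : c ≤ m := (List.le_of_isPrefix hcl).trans (h.le_head hl)
  have h2 : m ≤ a ++ (b' ++ c) :=
    (h.head.le_suffix ha ham).trans (List.le_append _ _)
  have h3 : a ++ (b' ++ c) < c := by
    rw [← List.append_assoc] at hab ⊢
    exact hab.lt_suffix (by simp [ha]) hc
  exact absurd (h3.trans_le (h1.trans h2)) (lt_irrefl _)

/-- The first factor of a chain is the longest Lyndon prefix of the product. -/
theorem IsLyndonChain.prefix_head {X : Type*} [LinearOrder X] {m : List X}
    {L : List (List X)} (h : IsLyndonChain (m :: L)) {u : List X} (hu : IsLyndon u)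
    (hp : u <+: (m :: L).flatten) : u <+: m := by
  obtain ⟨r, hr⟩ := hp
  rw [List.flatten_cons] at hr
  rcases List.append_eq_append_iff.1 hr with ⟨s, hm, -⟩ | ⟨s, hm, hs⟩
  · exact ⟨s, hm.symm⟩
  · by_cases hs0 : s = []
    · subst hs0
      exact ⟨[], by simpa using hm⟩
    · subst hm
      exact absurd hu (h.not_isLyndon_append h.head.1 hs0 List.suffix_rfl ⟨r, hs.symm⟩)

/-- The factorization into a nonincreasing product of Lyndon words is unique. -/
theorem IsLyndonChain.eq_of_flatten_eq {X : Type*} [LinearOrder X] {L L' : List (List X)}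
    (h : IsLyndonChain L) (h' : IsLyndonChain L') (heq : L.flatten = L'.flatten) : L = L' := by
  induction L generalizing L' with
  | nil =>
    cases L' with
    | nil => rfl
    | cons m' L' =>
      have := h'.head.1
      simp_all
  | cons m L ih =>
    cases L' with
    | nil =>
      have := h.head.1
      simp_all
    | cons m' L' =>
      have h1 : m <+: m' := h'.prefix_head h.head (by rw [← heq]; simp)
      have h2 : m' <+: m := h.prefix_head h'.head (by rw [heq]; simp)
      obtain rfl : m = m' := h1.eq_of_length (le_antisymm h1.length_le h2.length_le)
      rw [ih h.tail h'.tail (by simpa using heq)]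

/-- A Lyndon subword of a nonincreasing product of Lyndon words is a subword of a factor. -/
theorem IsLyndonChain.exists_infix {X : Type*} [LinearOrder X] {L : List (List X)}
    (h : IsLyndonChain L) {u : List X} (hu : IsLyndon u) (hi : u <:+: L.flatten) :
    ∃ l ∈ L, u <:+: l := by
  induction L with
  | nil => exact absurd (List.infix_nil.1 hi) hu.1
  | cons m L ih =>
    rw [List.flatten_cons, List.infix_append_iff] at hi
    rcases hi with hi | hi | ⟨a, b, rfl, ha, hb⟩
    · exact ⟨m, List.mem_cons_self, hi⟩
    · obtain ⟨l, hl, hul⟩ := ih h.tail hi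
      exact ⟨l, List.mem_cons_of_mem _ hl, hul⟩
    · by_cases ha0 : a = []
      · subst ha0
        obtain ⟨l, hl, hul⟩ := ih h.tail hb.isInfix
        exact ⟨l, List.mem_cons_of_mem _ hl, hul⟩
      · by_cases hb0 : b = []
        · subst hb0
          exact ⟨m, List.mem_cons_self, by simpa using ha.isInfix⟩
        · exact absurd hu (h.not_isLyndon_append ha0 hb0 ha hb)

/-- Put a Lyndon word in front of a chain, merging it with the first factors while it is smaller
than the next one. -/
def lyndonInsert {X : Type*} [LinearOrder X] : List X → List (List X) → List (List X)
  | l, [] => [l]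
  | l, m :: L => if l < m then lyndonInsert (l ++ m) L else l :: m :: L

/-- The factorization of a word into a nonincreasing product of Lyndon words. -/
def lyndonFactors {X : Type*} [LinearOrder X] : List X → List (List X)
  | [] => []
  | x :: w => lyndonInsert [x] (lyndonFactors w)

theorem isLyndonChain_lyndonInsert {X : Type*} [LinearOrder X] {l : List X} {L : List (List X)}
    (hl : IsLyndon l) (h : IsLyndonChain L) : IsLyndonChain (lyndonInsert l L) := by
  induction L generalizing l with
  | nil => exact isLyndonChain_nil.cons hl (by simp)
  | cons m L ih =>
    rw [lyndonInsert]
    split_ifs with hlm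
    · exact ih (hl.append h.head hlm) h.tail
    · refine h.cons hl fun m' hm' => ?_
      rcases List.mem_cons.1 hm' with rfl | hm'
      · exact not_lt.1 hlm
      · exact (h.le_head hm').trans (not_lt.1 hlm)

/-- Inserting merges the new word with an initial segment of the chain. -/
theorem exists_lyndonInsert_eq {X : Type*} [LinearOrder X] (l : List X) (L : List (List X)) :
    ∃ L₁ L₂, L = L₁ ++ L₂ ∧ lyndonInsert l L = (l ++ L₁.flatten) :: L₂ := by
  induction L generalizing l with
  | nil => exact ⟨[], [], rfl, by simp [lyndonInsert]⟩
  | cons m L ih =>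
    rw [lyndonInsert]
    split_ifs with hlm
    · obtain ⟨L₁, L₂, rfl, h⟩ := ih (l ++ m)
      exact ⟨m :: L₁, L₂, rfl, by simp [h]⟩
    · exact ⟨[], m :: L, rfl, by simp⟩

theorem isLyndonChain_lyndonFactors {X : Type*} [LinearOrder X] (w : List X) :
    IsLyndonChain (lyndonFactors w) := by
  induction w with
  | nil => exact isLyndonChain_nil
  | cons x w ih => exact isLyndonChain_lyndonInsert (isLyndon_singleton x) ih

@[simp] theorem flatten_lyndonFactors {X : Type*} [LinearOrder X] (w : List X) :
    (lyndonFactors w).flatten = w := by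
  induction w with
  | nil => rfl
  | cons x w ih =>
    obtain ⟨L₁, L₂, h₁, h₂⟩ := exists_lyndonInsert_eq [x] (lyndonFactors w)
    rw [lyndonFactors, h₂]
    rw [h₁] at ih
    simpa using ih

theorem IsLyndonChain.lyndonFactors_flatten {X : Type*} [LinearOrder X] {L : List (List X)}
    (h : IsLyndonChain L) : lyndonFactors L.flatten = L :=
  (isLyndonChain_lyndonFactors _).eq_of_flatten_eq h (flatten_lyndonFactors _)

/-- The first Lyndon factor of `x :: w`. -/
def lyndonHead {X : Type*} [LinearOrder X] (w : List X) : List X :=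
  (lyndonFactors w).headD []

/-- Prepending a letter is a local change: the leading block `L₁` merges with `x`, and the rest
survives. Being a segment of a chain, `L₁` is the factorization of its own product, so the change of
exponents depends on the new first factor alone. -/
theorem lyndonFactors_cons {X : Type*} [LinearOrder X] (x : X) (w : List X) :
    ∃ L₁ L₂, lyndonFactors w = L₁ ++ L₂ ∧ lyndonFactors (x :: w) = lyndonHead (x :: w) :: L₂ ∧
      lyndonFactors (lyndonHead (x :: w)).tail = L₁ := by
  obtain ⟨L₁, L₂, h₁, h₂⟩ := exists_lyndonInsert_eq [x] (lyndonFactors w)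
  have h : lyndonHead (x :: w) = [x] ++ L₁.flatten := by
    rw [lyndonHead, lyndonFactors, h₂, List.headD_cons]
  refine ⟨L₁, L₂, h₁, by rw [lyndonFactors, h₂, h], ?_⟩
  rw [h]
  refine IsLyndonChain.lyndonFactors_flatten ((isLyndonChain_lyndonFactors w).sublist ?_)
  rw [h₁]
  exact List.sublist_append_left L₁ L₂

theorem lyndonHead_cons {X : Type*} [LinearOrder X] (x : X) (w : List X) :
    IsLyndon (lyndonHead (x :: w)) ∧ lyndonHead (x :: w) <+: x :: w ∧
      ∀ u, IsLyndon u → u <+: x :: w → u <+: lyndonHead (x :: w) := by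
  obtain ⟨L₁, L₂, -, h, -⟩ := lyndonFactors_cons x w
  have hc := isLyndonChain_lyndonFactors (x :: w)
  have hf := flatten_lyndonFactors (x :: w)
  rw [h] at hc hf
  refine ⟨hc.head, ⟨L₂.flatten, by simpa using hf⟩, fun u hu hp => hc.prefix_head hu ?_⟩
  rwa [hf]

/-- The first factor is the longest Lyndon prefix, so any prefix long enough to contain it already
determines it. -/
theorem lyndonHead_eq_of_prefix {X : Type*} [LinearOrder X] {x : X} {v w : List X}
    (h : v <+: w) (hl : (lyndonHead (x :: w)).length ≤ v.length + 1) :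
    lyndonHead (x :: v) = lyndonHead (x :: w) := by
  obtain ⟨a1, a2, a3⟩ := lyndonHead_cons x v
  obtain ⟨b1, b2, b3⟩ := lyndonHead_cons x w
  have hvw : x :: v <+: x :: w := (List.prefix_cons_inj x).2 h
  have h1 := b3 _ a1 (a2.trans hvw)
  have h2 := a3 _ b1 (List.prefix_of_prefix_length_le b2 hvw (by simpa using hl))
  exact h1.eq_of_length (le_antisymm h1.length_le h2.length_le)

/-- A product of at most `D` Lyndon words that equals a nonincreasing product of `D` Lyndon words
is the same product. -/
theorem IsLyndonChain.eq_of_length_le {X : Type*} [LinearOrder X] {L M : List (List X)}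
    (hL : IsLyndonChain L) (hM : ∀ m ∈ M, IsLyndon m) (hlen : M.length ≤ L.length)
    (heq : M.flatten = L.flatten) : M = L := by
  -- Refactoring only merges: a list of Lyndon words that is not already a chain has strictly more
  -- entries than the factorization of its product.
  suffices H : ∀ M : List (List X), (∀ m ∈ M, IsLyndon m) →
      IsLyndonChain M ∨ (lyndonFactors M.flatten).length < M.length by
    rcases H M hM with h | h
    · exact h.eq_of_flatten_eq hL heq
    · rw [heq, hL.lyndonFactors_flatten] at h
      omega
  have hins : ∀ (L : List (List X)) (l : List X),
      (lyndonInsert l L).length ≤ L.length + 1 := by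
    intro L l
    obtain ⟨L₁, L₂, rfl, h⟩ := exists_lyndonInsert_eq l L
    simp [h]
  have hflat : ∀ (L : List (List X)) (l : List X),
      (lyndonInsert l L).flatten = l ++ L.flatten := by
    intro L l
    obtain ⟨L₁, L₂, rfl, h⟩ := exists_lyndonInsert_eq l L
    simp [h]
  intro M hM
  induction M with
  | nil => exact Or.inl isLyndonChain_nil
  | cons m M ih =>
    have hm := hM m List.mem_cons_self
    have hc := isLyndonChain_lyndonInsert hm (isLyndonChain_lyndonFactors M.flatten)
    have heq : lyndonFactors (m :: M).flatten = lyndonInsert m (lyndonFactors M.flatten) := by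
      rw [← hc.lyndonFactors_flatten, hflat]
      simp
    have h1 := hins (lyndonFactors M.flatten) m
    rcases ih fun l hl => hM l (List.mem_cons_of_mem _ hl) with h | h
    · rw [h.lyndonFactors_flatten] at heq h1
      obtain ⟨L₁, L₂, h2, h3⟩ := exists_lyndonInsert_eq m M
      -- If nothing merges, `m :: M` is itself a chain; otherwise at least one factor is lost.
      rcases L₁ with _ | ⟨l, L₁⟩
      · left
        rw [h.lyndonFactors_flatten, h3] at hc
        simpa [h2] using hc
      · right
        rw [heq, h3, h2]
        simp
    · right
      rw [heq, List.length_cons]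
      omega

/-- A Lyndon word with at least two letters is a product of two Lyndon words. -/
theorem IsLyndon.exists_append {X : Type*} [LinearOrder X] {w : List X} (hw : IsLyndon w)
    (h2 : 2 ≤ w.length) : ∃ a b, IsLyndon a ∧ IsLyndon b ∧ w = a ++ b := by
  -- When insertion collapses a nonempty chain to the single word `w`, its last merge splits `w`
  -- into the accumulated Lyndon word and the last factor.
  have H : ∀ (L : List (List X)) (l : List X), IsLyndon l → IsLyndonChain L → L ≠ [] →
      lyndonInsert l L = [w] → ∃ a b, IsLyndon a ∧ IsLyndon b ∧ w = a ++ b := by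
    intro L
    induction L with
    | nil => simp
    | cons m L ih =>
      intro l hl hL _ h
      rw [lyndonInsert] at h
      split_ifs at h with hlm
      · by_cases hL0 : L = []
        · subst hL0
          rw [lyndonInsert] at h
          exact ⟨l, m, hl, hL.head, by simpa using h.symm⟩
        · exact ih _ (hl.append hL.head hlm) hL.tail hL0 h
      · simp at h
  rcases w with _ | ⟨x, _ | ⟨y, w⟩⟩
  · simp at h2
  · simp at h2
  · refine H (lyndonFactors (y :: w)) [x] (isLyndon_singleton x)
      (isLyndonChain_lyndonFactors _) ?_ ?_
    · intro h
      have := flatten_lyndonFactors (y :: w)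
      simp [h] at this
    · have hc : IsLyndonChain [x :: y :: w] := isLyndonChain_nil.cons hw (by simp)
      have := hc.lyndonFactors_flatten
      simpa [lyndonFactors] using this

/-! ### Normal words -/

theorem normalWords_of_infix {X : Type*} {W : Set (List X)} {v w : List X}
    (hw : w ∈ normalWords W) (h : v <:+: w) : v ∈ normalWords W :=
  fun u hu huv => hw u hu (huv.trans h)

theorem nil_mem_normalWords {X : Type*} [LinearOrder X] {W : Set (List X)}
    (hW : ∀ w ∈ W, IsLyndon w) : [] ∈ normalWords W :=
  fun u hu h => (hW u hu).1 (List.infix_nil.1 h)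

theorem mem_lyndonAtoms_of_mem_lyndonFactors {X : Type*} [LinearOrder X] {W : Set (List X)}
    {w l : List X} (hw : w ∈ normalWords W) (hl : l ∈ lyndonFactors w) : l ∈ lyndonAtoms W := by
  refine ⟨(isLyndonChain_lyndonFactors w).isLyndon l hl, normalWords_of_infix hw ?_⟩
  have := List.infix_of_mem_flatten hl
  rwa [flatten_lyndonFactors] at this

/-- A forbidden subword is Lyndon, so it would have to lie inside a single factor. -/
theorem IsLyndonChain.flatten_mem_normalWords {X : Type*} [LinearOrder X] {W : Set (List X)}
    (hW : ∀ w ∈ W, IsLyndon w) {L : List (List X)} (hL : IsLyndonChain L)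
    (h : ∀ l ∈ L, l ∈ lyndonAtoms W) : L.flatten ∈ normalWords W := by
  intro u hu hi
  obtain ⟨l, hl, hul⟩ := hL.exists_infix (hW u hu) hi
  exact (h l hl).2 u hu hul

/-- The list `l₁, …, l₁, …, lₛ, …, lₛ` with `k i` copies of `l i`. -/
def powList {X : Type*} {s : ℕ} (l : Fin s → List X) (k : Fin s → ℕ) : List (List X) :=
  (List.ofFn fun i => List.replicate (k i) (l i)).flatten

theorem flatten_powList {X : Type*} {s : ℕ} (l : Fin s → List X) (k : Fin s → ℕ) :
    (powList l k).flatten = powProd l k := by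
  rw [powList, powProd, List.flatten_flatten, List.map_ofFn]
  rfl

theorem mem_powList {X : Type*} {s : ℕ} {l : Fin s → List X} {k : Fin s → ℕ} {w : List X}
    (h : w ∈ powList l k) : ∃ i, l i = w := by
  rw [powList, List.mem_flatten] at h
  obtain ⟨L, hL, hw⟩ := h
  obtain ⟨i, rfl⟩ := (List.mem_ofFn' _ _).1 hL
  exact ⟨i, (List.eq_of_mem_replicate hw).symm⟩

theorem isLyndonChain_powList {X : Type*} [LinearOrder X] {s : ℕ} {l : Fin s → List X}
    (hl : StrictAnti l) (h : ∀ i, IsLyndon (l i)) (k : Fin s → ℕ) :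
    IsLyndonChain (powList l k) := by
  refine ⟨fun w hw => ?_, ?_⟩
  · obtain ⟨i, rfl⟩ := mem_powList hw
    exact h i
  · rw [powList, List.pairwise_flatten, List.pairwise_ofFn]
    refine ⟨fun L hL => ?_, fun i j hij a ha b hb => ?_⟩
    · obtain ⟨i, rfl⟩ := (List.mem_ofFn' _ _).1 hL
      exact List.pairwise_replicate.2 (Or.inr le_rfl)
    · rw [List.eq_of_mem_replicate ha, List.eq_of_mem_replicate hb]
      exact (hl hij).le

theorem count_powList {X : Type*} [DecidableEq X] {s : ℕ} {l : Fin s → List X}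
    (hl : Function.Injective l) (k : Fin s → ℕ) (i : Fin s) :
    (powList l k).count (l i) = k i := by
  rw [powList, List.count_flatten, List.map_ofFn, List.sum_ofFn,
    Finset.sum_eq_single i]
  · simp
  · intro j _ hj
    simp [List.count_replicate, hl.ne hj]
  · simp

theorem powProd_injective {X : Type*} [LinearOrder X] {s : ℕ} {l : Fin s → List X}
    (hl : StrictAnti l) (h : ∀ i, IsLyndon (l i)) : Function.Injective (powProd l) := by
  intro k k' hk
  rw [← flatten_powList, ← flatten_powList] at hk
  have := (isLyndonChain_powList hl h k).eq_of_flatten_eq (isLyndonChain_powList hl h k') hk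
  funext i
  rw [← count_powList hl.injective k i, this, count_powList hl.injective]

theorem IsLyndonChain.eq_powList {X : Type*} [LinearOrder X] {s : ℕ} {l : Fin s → List X}
    (hl : StrictAnti l) (h : ∀ i, IsLyndon (l i)) {L : List (List X)} (hL : IsLyndonChain L)
    (hsub : ∀ w ∈ L, ∃ i, l i = w) : L = powList l fun i => L.count (l i) := by
  refine List.Perm.eq_of_pairwise (le := fun a b => b ≤ a) (fun a b _ _ h1 h2 => le_antisymm h2 h1)
    hL.pairwise (isLyndonChain_powList hl h _).pairwise (List.perm_iff_count.2 fun w => ?_)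
  by_cases hw : ∃ i, l i = w
  · obtain ⟨i, rfl⟩ := hw
    rw [count_powList hl.injective]
  · rw [List.count_eq_zero_of_not_mem fun h' => hw (hsub w h'),
      List.count_eq_zero_of_not_mem fun h' => hw (mem_powList h')]

theorem exists_strictAnti_range_eq {α : Type*} [LinearOrder α] (F : Finset α) :
    ∃ l : Fin F.card → α, StrictAnti l ∧ Set.range l = F := by
  refine ⟨fun i => F.orderEmbOfFin rfl (Fin.rev i), fun i j hij => ?_, ?_⟩
  · exact (F.orderEmbOfFin rfl).strictMono (Fin.rev_lt_rev.2 hij)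
  · rw [← Finset.range_orderEmbOfFin F rfl]
    exact Fin.rev_surjective.range_comp (F.orderEmbOfFin rfl)

theorem powProd_mem_normalWords {X : Type*} [LinearOrder X] {W : Set (List X)}
    (hW : ∀ w ∈ W, IsLyndon w) {s : ℕ} {l : Fin s → List X} (hl : StrictAnti l)
    (h : ∀ i, l i ∈ lyndonAtoms W) (k : Fin s → ℕ) : powProd l k ∈ normalWords W := by
  rw [← flatten_powList]
  refine (isLyndonChain_powList hl (fun i => (h i).1) k).flatten_mem_normalWords hW fun w hw => ?_
  obtain ⟨i, rfl⟩ := mem_powList hw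
  exact h i

theorem normalWords_eq {X : Type*} [LinearOrder X] {W : Set (List X)}
    (hW : ∀ w ∈ W, IsLyndon w) : normalWords W =
      {w | ∃ (s : ℕ) (l : Fin s → List X) (k : Fin s → ℕ),
        StrictAnti l ∧ (∀ i, l i ∈ lyndonAtoms W) ∧ w = powProd l k} := by
  ext w
  constructor
  · intro hw
    obtain ⟨l, hl, hr⟩ := exists_strictAnti_range_eq (lyndonFactors w).toFinset
    have hmem : ∀ i, l i ∈ lyndonFactors w := fun i => by
      have : l i ∈ Set.range l := ⟨i, rfl⟩
      rw [hr] at this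
      simpa using this
    have hc := isLyndonChain_lyndonFactors w
    refine ⟨_, l, fun i => (lyndonFactors w).count (l i), hl,
      fun i => mem_lyndonAtoms_of_mem_lyndonFactors hw (hmem i), ?_⟩
    rw [← flatten_powList, ← hc.eq_powList hl (fun i => hc.isLyndon _ (hmem i)),
      flatten_lyndonFactors]
    intro v hv
    have : v ∈ Set.range l := by rw [hr]; simpa using hv
    exact this
  · rintro ⟨s, l, k, hl, h, rfl⟩
    exact powProd_mem_normalWords hW hl h k

theorem normalWords_eq_range {X : Type*} [LinearOrder X] {W : Set (List X)}
    (hW : ∀ w ∈ W, IsLyndon w) {s : ℕ} {l : Fin s → List X} (hl : StrictAnti l)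
    (hr : Set.range l = lyndonAtoms W) : normalWords W = Set.range (powProd l) := by
  have h : ∀ i, l i ∈ lyndonAtoms W := fun i => hr ▸ ⟨i, rfl⟩
  ext w
  constructor
  · intro hw
    have hc := isLyndonChain_lyndonFactors w
    refine ⟨fun i => (lyndonFactors w).count (l i), ?_⟩
    rw [← flatten_powList, ← hc.eq_powList hl (fun i => (h i).1), flatten_lyndonFactors]
    intro v hv
    have := mem_lyndonAtoms_of_mem_lyndonFactors hw hv
    rwa [← hr] at this
  · rintro ⟨k, rfl⟩
    exact powProd_mem_normalWords hW hl h k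

theorem length_powProd {X : Type*} {s : ℕ} (l : Fin s → List X) (k : Fin s → ℕ) :
    (powProd l k).length = ∑ i, k i * (l i).length := by
  simp [powProd, List.length_flatten, List.map_ofFn, List.sum_ofFn, Function.comp_def]

/-- If there are finitely many atoms, the forbidden words have bounded length. -/
theorem exists_length_bound {X : Type*} [LinearOrder X] {W : Set (List X)}
    (hW : ∀ w ∈ W, IsLyndon w) (hanti : IsAntichain (fun u w : List X => u <:+: w) W)
    (hfin : (lyndonAtoms W).Finite) :
    ∃ M, (∀ l ∈ lyndonAtoms W, l.length ≤ M) ∧ ∀ u ∈ W, u.length ≤ M := by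
  obtain ⟨B, hB⟩ := (hfin.image List.length).bddAbove
  have hB' : ∀ l ∈ lyndonAtoms W, l.length ≤ B := fun l hl => hB ⟨l, hl, rfl⟩
  -- The summand `2 * B` covers forbidden words that split into two atoms, the `1` covers forbidden
  -- letters.
  refine ⟨2 * B + 1, fun l hl => by have := hB' l hl; omega, fun u hu => ?_⟩
  by_cases h2 : 2 ≤ u.length
  · obtain ⟨a, b, ha, hb, rfl⟩ := (hW u hu).exists_append h2
    -- A proper subword of `u ∈ W` contains no element of `W`, by the antichain condition.
    have hatom : ∀ v, IsLyndon v → v <:+: a ++ b → v.length < (a ++ b).length →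
        v ∈ lyndonAtoms W := by
      refine fun v hv hi hlt => ⟨hv, fun u' hu' hi' => ?_⟩
      have := hanti.eq hu' hu (hi'.trans hi)
      subst this
      exact absurd hi'.length_le (not_le.2 hlt)
    have ha0 := List.length_pos_of_ne_nil ha.1
    have hb0 := List.length_pos_of_ne_nil hb.1
    have h1 := hB' a (hatom a ha (List.prefix_append a b).isInfix (by simp; omega))
    have h2 := hB' b (hatom b hb (List.suffix_append a b).isInfix (by simp; omega))
    simp only [List.length_append]
    omega
  · omega

/-! ### The basis of normal words -/

section Basis

variable {K : Type*} [Field K] {X : Type*} {W : Set (List X)}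

theorem monomialOfWord_append (v w : List X) :
    monomialOfWord K (v ++ w) = monomialOfWord K v * monomialOfWord K w := by
  simp [monomialOfWord]

theorem wordClass_nil : wordClass K W [] = 1 := by
  simp [wordClass, monomialOfWord]

theorem wordClass_append (v w : List X) :
    wordClass K W (v ++ w) = wordClass K W v * wordClass K W w := by
  rw [wordClass, monomialOfWord_append, map_mul]
  rfl

theorem wordClass_flatten (L : List (List X)) :
    wordClass K W L.flatten = (L.map (wordClass K W)).prod := by
  induction L with
  | nil => exact wordClass_nil
  | cons l L ih => simp [wordClass_append, ih]

theorem wordClass_eq_zero {w : List X} (hw : w ∉ normalWords W) : wordClass K W w = 0 := by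
  simp only [normalWords, Set.mem_ofPred_eq, not_forall, not_not] at hw
  obtain ⟨u, hu, a, b, rfl⟩ := hw
  have : wordClass K W u = 0 := by
    have h : monomialOfWord K u ∈ TwoSidedIdeal.span (monomialOfWord K '' W) :=
      TwoSidedIdeal.subset_span ⟨u, hu, rfl⟩
    exact (RingCon.eq _).2 h
  rw [wordClass_append, wordClass_append, this, mul_zero, zero_mul]

theorem span_range_monomialOfWord :
    Submodule.span K (Set.range (monomialOfWord K (X := X))) = ⊤ := by
  rw [eq_top_iff]
  rintro f -
  induction f with
  | grade0 r =>
    rw [Algebra.algebraMap_eq_smul_one]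
    exact Submodule.smul_mem _ _ (Submodule.subset_span ⟨[], by simp [monomialOfWord]⟩)
  | grade1 x => exact Submodule.subset_span ⟨[x], by simp [monomialOfWord]⟩
  | mul a b ha hb =>
    have := Submodule.mul_mem_mul ha hb
    rw [Submodule.span_mul_span] at this
    refine Submodule.span_mono ?_ this
    rintro _ ⟨_, ⟨v, rfl⟩, _, ⟨w, rfl⟩, rfl⟩
    exact ⟨v ++ w, monomialOfWord_append v w⟩
  | add a b ha hb => exact add_mem ha hb

theorem span_range_wordClass : Submodule.span K (Set.range (wordClass K W)) = ⊤ := by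
  rw [eq_top_iff]
  rintro a -
  obtain ⟨f, rfl⟩ := (TwoSidedIdeal.span (monomialOfWord K '' W)).ringCon.mkₐ_surjective
    (α := K) a
  have h : f ∈ Submodule.span K (Set.range (monomialOfWord K (X := X))) := by
    rw [span_range_monomialOfWord]
    trivial
  have := Submodule.mem_map_of_mem
    (f := ((TwoSidedIdeal.span (monomialOfWord K '' W)).ringCon.mkₐ (α := K)).toLinearMap) h
  rw [Submodule.map_span, ← Set.range_comp] at this
  exact this

theorem span_image_wordClass (S : Set (List X)) :
    Submodule.span K (wordClass K W '' S) =
      Submodule.span K (wordClass K W '' (S ∩ normalWords W)) := by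
  refine le_antisymm (Submodule.span_le.2 ?_)
    (Submodule.span_mono (Set.image_mono Set.inter_subset_left))
  rintro _ ⟨w, hw, rfl⟩
  by_cases h : w ∈ normalWords W
  · exact Submodule.subset_span ⟨w, ⟨hw, h⟩, rfl⟩
  · rw [wordClass_eq_zero h]
    exact zero_mem _

theorem span_wordClass_normalWords :
    Submodule.span K (wordClass K W '' normalWords W) = ⊤ := by
  rw [← span_range_wordClass, ← Set.image_univ, span_image_wordClass Set.univ, Set.univ_inter]

theorem lift_monomialOfWord {B : Type*} [Ring B] [Algebra K B] (f : X → B) (w : List X) :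
    FreeAlgebra.lift K f (monomialOfWord K w) = (w.map f).prod := by
  rw [monomialOfWord, map_list_prod, List.map_map]
  congr 2
  funext x
  simp

/-- The algebra homomorphism from a monomial algebra given by images of the letters for which the
forbidden words vanish. -/
noncomputable def MonomialAlgebra.lift {B : Type*} [Ring B] [Algebra K B] (f : X → B)
    (hf : ∀ u ∈ W, (u.map f).prod = 0) : MonomialAlgebra K W →ₐ[K] B :=
  RingCon.liftₐ _ (FreeAlgebra.lift K f) (by
    have h : TwoSidedIdeal.span (monomialOfWord K '' W) ≤
        TwoSidedIdeal.ker (FreeAlgebra.lift K f) := by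
      rw [TwoSidedIdeal.span_le]
      rintro _ ⟨u, hu, rfl⟩
      rw [SetLike.mem_coe, TwoSidedIdeal.mem_ker, lift_monomialOfWord, hf u hu]
    exact TwoSidedIdeal.ringCon_le_iff.1 h)

theorem MonomialAlgebra.lift_wordClass {B : Type*} [Ring B] [Algebra K B] (f : X → B)
    (hf : ∀ u ∈ W, (u.map f).prod = 0) (w : List X) :
    MonomialAlgebra.lift (K := K) f hf (wordClass K W w) = (w.map f).prod :=
  lift_monomialOfWord f w

open Classical in
/-- Left multiplication by a letter on the space with basis the words, where the words that are not
normal are replaced by zero. -/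
noncomputable def letterAction (K : Type*) [Field K] (W : Set (List X)) (x : X) :
    Module.End K (List X →₀ K) :=
  Finsupp.linearCombination K fun w =>
    if x :: w ∈ normalWords W then Finsupp.single (x :: w) (1 : K) else 0

open Classical in
theorem letterAction_single (x : X) (w : List X) :
    letterAction K W x (Finsupp.single w 1) =
      if x :: w ∈ normalWords W then Finsupp.single (x :: w) (1 : K) else 0 := by
  simp [letterAction]

open Classical in
-- Suffixes of normal words are normal, so testing after every letter equals testing once at the
-- end. The hypothesis excludes the case where no letter is applied to a nonnormal `w`, when no test
-- takes place.
theorem letterAction_prod_single (v w : List X) (h : w ∈ normalWords W ∨ v ≠ []) :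
    (v.map (letterAction K W)).prod (Finsupp.single w 1) =
      if v ++ w ∈ normalWords W then Finsupp.single (v ++ w) (1 : K) else 0 := by
  induction v with
  | nil => simp_all
  | cons x v ih =>
    rw [List.map_cons, List.prod_cons, Module.End.mul_apply]
    by_cases hv : v = []
    · subst hv
      simp [letterAction_single]
    · rw [ih (Or.inr hv)]
      by_cases hn : v ++ w ∈ normalWords W
      · rw [if_pos hn, letterAction_single, List.cons_append]
      · rw [if_neg hn, map_zero, if_neg]
        exact fun h' => hn (normalWords_of_infix h' (List.suffix_cons x _).isInfix)

theorem letterAction_prod_eq_zero (h0 : [] ∈ normalWords W) {u : List X} (hu : u ∈ W) :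
    (u.map (letterAction K W)).prod = 0 := by
  classical
  refine Finsupp.lhom_ext' fun w => LinearMap.ext_ring ?_
  have hu0 : u ≠ [] := by
    rintro rfl
    exact h0 _ hu List.infix_rfl
  have : (u.map (letterAction K W)).prod (Finsupp.single w 1) = 0 := by
    rw [letterAction_prod_single u w (Or.inr hu0), if_neg]
    exact fun h => h u hu (List.prefix_append u w).isInfix
  simpa using this

/-- The coordinates with respect to the basis of normal words. -/
noncomputable def normalForm (K : Type*) [Field K] (h0 : [] ∈ normalWords W) :
    MonomialAlgebra K W →ₗ[K] (List X →₀ K) :=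
  (LinearMap.applyₗ (Finsupp.single [] (1 : K))).comp
    (MonomialAlgebra.lift (letterAction K W)
      fun _ hu => letterAction_prod_eq_zero h0 hu).toLinearMap

open Classical in
theorem normalForm_wordClass (h0 : [] ∈ normalWords W) (w : List X) :
    normalForm K h0 (wordClass K W w) =
      if w ∈ normalWords W then Finsupp.single w (1 : K) else 0 := by
  have : normalForm K h0 (wordClass K W w) =
      MonomialAlgebra.lift (letterAction K W) (fun _ hu => letterAction_prod_eq_zero h0 hu)
        (wordClass K W w) (Finsupp.single [] (1 : K)) := rfl
  rw [this, MonomialAlgebra.lift_wordClass, letterAction_prod_single w [] (Or.inl h0),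
    List.append_nil]

/-- Acting on the empty word turns the class of a normal word into that word as a basis vector. -/
theorem linearIndependent_wordClass (h0 : [] ∈ normalWords W) :
    LinearIndependent K (fun w : normalWords W => wordClass K W w) := by
  classical
  refine LinearIndependent.of_comp (normalForm K h0) ?_
  have : (normalForm K h0 ∘ fun w : normalWords W => wordClass K W w) =
      (fun w : List X => Finsupp.single w (1 : K)) ∘ Subtype.val := by
    funext w
    simp [normalForm_wordClass, w.2]
  rw [this]
  exact (Finsupp.linearIndependent_single_one K (List X)).comp _ Subtype.val_injective

theorem finrank_span_wordClass (h0 : [] ∈ normalWords W) {S : Set (List X)} (hS : S.Finite) :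
    Module.finrank K (Submodule.span K (wordClass K W '' S)) = (S ∩ normalWords W).ncard := by
  rw [span_image_wordClass]
  have hfin : (S ∩ normalWords W).Finite := hS.inter_of_left _
  have := hfin.fintype
  have hli : LinearIndependent K
      (fun w : (S ∩ normalWords W : Set (List X)) => wordClass K W w) :=
    (linearIndependent_wordClass h0).comp
      (fun w : (S ∩ normalWords W : Set (List X)) => (⟨w.1, w.2.2⟩ : normalWords W))
      fun v w h => Subtype.ext (Subtype.mk.inj h)
  have h := finrank_span_eq_card hli
  rw [← Nat.card_eq_fintype_card, Nat.card_coe_set_eq] at h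
  rw [← h, Set.image_eq_range (wordClass K W)]

theorem finrank_component [Finite X] (h0 : [] ∈ normalWords W) (n : ℕ) :
    Module.finrank K (component K W n) = ({w | w.length = n} ∩ normalWords W).ncard :=
  finrank_span_wordClass h0 (List.finite_length_eq X n)

end Basis

/-! ### Growth -/

/-- The predicate serves both `= n`, for graded components, and `≤ n`, for the length filtration. -/
theorem ncard_inter_normalWords {X : Type*} [LinearOrder X] {W : Set (List X)}
    (hW : ∀ w ∈ W, IsLyndon w) {s : ℕ} {l : Fin s → List X} (hl : StrictAnti l)
    (hr : Set.range l = lyndonAtoms W) (P : ℕ → Prop) :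
    ({w | P w.length} ∩ normalWords W).ncard =
      {k : Fin s → ℕ | P (∑ i, k i * (l i).length)}.ncard := by
  have h : ∀ i, l i ∈ lyndonAtoms W := fun i => hr ▸ ⟨i, rfl⟩
  rw [← Set.ncard_image_of_injective _ (powProd_injective hl fun i => (h i).1),
    normalWords_eq_range hW hl hr]
  congr 1
  ext w
  constructor
  · rintro ⟨hw, k, rfl⟩
    exact ⟨k, by simpa [length_powProd] using hw, rfl⟩
  · rintro ⟨k, hk, rfl⟩
    exact ⟨by simpa [length_powProd] using hk, k, rfl⟩

theorem setOf_sum_mul_le_subset {s : ℕ} {m : Fin s → ℕ} (hm : ∀ i, 0 < m i) (n : ℕ) :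
    {k : Fin s → ℕ | ∑ i, k i * m i ≤ n} ⊆
      (Fintype.piFinset fun _ : Fin s => Finset.range (n + 1) : Finset (Fin s → ℕ)) := by
  intro k hk
  simp only [Finset.mem_coe, Fintype.mem_piFinset, Finset.mem_range]
  intro i
  have h1 : k i * m i ≤ ∑ i, k i * m i :=
    Finset.single_le_sum (f := fun i => k i * m i) (fun _ _ => Nat.zero_le _) (Finset.mem_univ i)
  have h2 : k i ≤ k i * m i := Nat.le_mul_of_pos_right _ (hm i)
  have h3 : ∑ i, k i * m i ≤ n := hk
  omega

theorem finite_setOf_sum_mul_le {s : ℕ} {m : Fin s → ℕ} (hm : ∀ i, 0 < m i) (n : ℕ) :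
    {k : Fin s → ℕ | ∑ i, k i * m i ≤ n}.Finite :=
  (Finset.finite_toSet _).subset (setOf_sum_mul_le_subset hm n)

theorem ncard_setOf_sum_mul_le {s : ℕ} {m : Fin s → ℕ} (hm : ∀ i, 0 < m i) (n : ℕ) :
    {k : Fin s → ℕ | ∑ i, k i * m i ≤ n}.ncard ≤ (n + 1) ^ s := by
  refine (Set.ncard_le_ncard (setOf_sum_mul_le_subset hm n) (Finset.finite_toSet _)).trans ?_
  rw [Set.ncard_coe_finset]
  simp

/-- Together with `setOf_sum_mul_le_subset` this squeezes the exponent vectors between two boxes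
with sides linear in the length bound, whence growth of degree exactly `s`. -/
theorem piFinset_subset_setOf_sum_mul_le {s : ℕ} (m : Fin s → ℕ) (q : ℕ) :
    ((Fintype.piFinset fun _ : Fin s => Finset.range (q + 1) : Finset (Fin s → ℕ)) :
      Set (Fin s → ℕ)) ⊆ {k : Fin s → ℕ | ∑ i, k i * m i ≤ q * ∑ i, m i} := by
  intro k hk
  simp only [Finset.mem_coe, Fintype.mem_piFinset, Finset.mem_range] at hk
  change ∑ i, k i * m i ≤ q * ∑ i, m i
  rw [Finset.mul_sum]
  exact Finset.sum_le_sum fun i _ => Nat.mul_le_mul_right _ (Nat.lt_succ_iff.1 (hk i))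

theorem hasPolynomialGrowth_of_finite {K : Type*} [Field K] {X : Type*} [Finite X]
    [LinearOrder X] {W : Set (List X)} (hW : ∀ w ∈ W, IsLyndon w)
    (hfin : (lyndonAtoms W).Finite) : HasPolynomialGrowth (component K W) := by
  obtain ⟨s, l, hl, hr⟩ : ∃ (s : ℕ) (l : Fin s → List X), StrictAnti l ∧
      Set.range l = hfin.toFinset := ⟨_, exists_strictAnti_range_eq hfin.toFinset⟩
  rw [hfin.coe_toFinset] at hr
  have hm : ∀ i, 0 < (l i).length := fun i => by
    have : l i ∈ lyndonAtoms W := hr ▸ ⟨i, rfl⟩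
    exact List.length_pos_of_ne_nil this.1.1
  refine ⟨s, 2 ^ s, by positivity, fun n hn => ?_⟩
  rw [finrank_component (nil_mem_normalWords hW), ncard_inter_normalWords hW hl hr (· = n),
    Real.rpow_natCast, ← mul_pow]
  have h1 : {k : Fin s → ℕ | ∑ i, k i * (l i).length = n}.ncard ≤ (n + 1) ^ s :=
    (Set.ncard_le_ncard (fun k hk => le_of_eq hk) (finite_setOf_sum_mul_le hm n)).trans
      (ncard_setOf_sum_mul_le hm n)
  have h2 : (n + 1) ^ s ≤ (2 * n) ^ s := Nat.pow_le_pow_left (by omega) s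
  exact_mod_cast h1.trans h2

/-- A bound of degree `e` on the components gives one of degree `e + 1` on the words of length at
most `R`, whereas `e + 2` atoms produce a box of `(q + 1) ^ (e + 2)` normal words of length at most
`q * Λ`. -/
theorem finite_of_hasPolynomialGrowth {K : Type*} [Field K] {X : Type*} [Finite X]
    [LinearOrder X] {W : Set (List X)} (hW : ∀ w ∈ W, IsLyndon w)
    (hg : HasPolynomialGrowth (component K W)) : (lyndonAtoms W).Finite := by
  by_contra hinf
  obtain ⟨D, C, hC, hD⟩ := hg
  obtain ⟨e, he⟩ := exists_nat_ge D
  have hstep : ∀ n : ℕ, 1 ≤ n →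
      ((({w : List X | w.length = n} ∩ normalWords W).ncard : ℕ) : ℝ) ≤ C * (n : ℝ) ^ e := by
    intro n hn
    have h1 : (1 : ℝ) ≤ n := by exact_mod_cast hn
    have h2 := hD n hn
    rw [finrank_component (nil_mem_normalWords hW)] at h2
    refine h2.trans (mul_le_mul_of_nonneg_left ?_ hC.le)
    rw [← Real.rpow_natCast]
    exact Real.rpow_le_rpow_of_exponent_le h1 he
  have hsum : ∀ R : ℕ, ((({w : List X | w.length ≤ R} ∩ normalWords W).ncard : ℕ) : ℝ) ≤
      1 + C * (R : ℝ) ^ (e + 1) := by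
    intro R
    induction R with
    | zero =>
      have h1 : ({w : List X | w.length ≤ 0} ∩ normalWords W).ncard ≤ 1 := by
        rw [← Set.ncard_singleton ([] : List X)]
        refine Set.ncard_le_ncard ?_
        rintro w ⟨hw, -⟩
        exact List.length_eq_zero_iff.1 (Nat.le_zero.1 hw)
      have h2 : ((({w : List X | w.length ≤ 0} ∩ normalWords W).ncard : ℕ) : ℝ) ≤ 1 := by
        exact_mod_cast h1
      simpa using h2
    | succ R ih =>
      have h1 : ({w : List X | w.length ≤ R + 1} ∩ normalWords W) =
          ({w : List X | w.length ≤ R} ∩ normalWords W) ∪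
            ({w : List X | w.length = R + 1} ∩ normalWords W) := by
        rw [← Set.union_inter_distrib_right]
        congr 1
        ext w
        exact Nat.le_succ_iff
      have h2 := Set.ncard_union_le ({w : List X | w.length ≤ R} ∩ normalWords W)
        ({w : List X | w.length = R + 1} ∩ normalWords W)
      rw [← h1] at h2
      have h3 : ((({w : List X | w.length ≤ R + 1} ∩ normalWords W).ncard : ℕ) : ℝ) ≤
          (({w : List X | w.length ≤ R} ∩ normalWords W).ncard : ℕ) +
            (({w : List X | w.length = R + 1} ∩ normalWords W).ncard : ℕ) := by
        exact_mod_cast h2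
      have h4 := hstep (R + 1) (by omega)
      have h5 : (R : ℝ) ^ e ≤ ((R + 1 : ℕ) : ℝ) ^ e := by
        gcongr
        simp
      have h6 : C * (R : ℝ) ^ (e + 1) + C * ((R + 1 : ℕ) : ℝ) ^ e ≤
          C * ((R + 1 : ℕ) : ℝ) ^ (e + 1) := by
        rw [← mul_add]
        refine mul_le_mul_of_nonneg_left ?_ hC.le
        rw [pow_succ, pow_succ]
        push_cast at h5 ⊢
        have : (0 : ℝ) ≤ R := Nat.cast_nonneg R
        nlinarith
      linarith
  obtain ⟨F, hF, hcard⟩ := Set.Infinite.exists_subset_card_eq hinf (e + 2)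
  obtain ⟨l, hl, hr⟩ := exists_strictAnti_range_eq F
  have hatom : ∀ i, l i ∈ lyndonAtoms W := fun i => hF (hr ▸ ⟨i, rfl⟩)
  set Λ := ∑ i, (l i).length
  have hlow : ∀ q : ℕ, (q + 1) ^ (e + 2) ≤
      ({w : List X | w.length ≤ q * Λ} ∩ normalWords W).ncard := by
    intro q
    have h1 : (q + 1) ^ (e + 2) =
        (powProd l '' ((Fintype.piFinset fun _ : Fin F.card => Finset.range (q + 1) :
          Finset (Fin F.card → ℕ)) : Set (Fin F.card → ℕ))).ncard := by
      rw [Set.ncard_image_of_injective _ (powProd_injective hl fun i => (hatom i).1),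
        Set.ncard_coe_finset]
      simp [hcard]
    rw [h1]
    refine Set.ncard_le_ncard ?_ ((List.finite_length_le X _).inter_of_left _)
    rintro _ ⟨k, hk, rfl⟩
    refine ⟨?_, powProd_mem_normalWords hW hl hatom k⟩
    have := piFinset_subset_setOf_sum_mul_le (fun i => (l i).length) q hk
    change (powProd l k).length ≤ q * Λ
    rw [length_powProd]
    exact this
  -- With this `q`, the right side `1 + C (qΛ) ^ (e + 1)` is at most `q (q + 1) ^ (e + 1)`, less
  -- than the number of words.
  obtain ⟨q, hq⟩ := exists_nat_ge (1 + C * (Λ : ℝ) ^ (e + 1))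
  have h1 : (((q + 1) ^ (e + 2) : ℕ) : ℝ) ≤ 1 + C * ((q * Λ : ℕ) : ℝ) ^ (e + 1) :=
    (Nat.cast_le.2 (hlow q)).trans (hsum _)
  push_cast at h1
  rw [mul_pow, pow_succ] at h1
  have h2 : (q : ℝ) ^ (e + 1) ≤ (q + 1 : ℝ) ^ (e + 1) := by gcongr; linarith
  have h3 : (1 : ℝ) ≤ (q + 1 : ℝ) ^ (e + 1) :=
    one_le_pow₀ (by linarith [(Nat.cast_nonneg q : (0 : ℝ) ≤ q)])
  have h4 : (0 : ℝ) ≤ C * (Λ : ℝ) ^ (e + 1) := by positivity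
  nlinarith

/-! ### Hilbert series -/

theorem PowerSeries.one_sub_X_pow_inv {m : ℕ} (hm : 0 < m) :
    (1 - (PowerSeries.X : PowerSeries ℚ) ^ m)⁻¹ =
      PowerSeries.mk fun n => if m ∣ n then 1 else 0 := by
  have h0 : PowerSeries.constantCoeff (1 - (PowerSeries.X : PowerSeries ℚ) ^ m) ≠ 0 := by
    simp [hm.ne']
  symm
  rw [PowerSeries.eq_inv_iff_mul_eq_one h0]
  ext n
  rw [mul_sub, mul_one, map_sub, PowerSeries.coeff_mul_X_pow', PowerSeries.coeff_mk,
    PowerSeries.coeff_one]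
  by_cases h : m ≤ n
  · obtain ⟨j, rfl⟩ := Nat.exists_eq_add_of_le h
    simp [hm.ne']
  · have h1 : m ∣ n ↔ n = 0 := ⟨fun hd => Nat.eq_zero_of_dvd_of_lt hd (by omega),
      by rintro rfl; simp⟩
    simp [h, h1]

theorem hilbertSeries_eq {K : Type*} [Field K] {X : Type*} [Finite X]
    [LinearOrder X] {W : Set (List X)} (hW : ∀ w ∈ W, IsLyndon w)
    {s : ℕ} {l : Fin s → List X} (hl : StrictAnti l) (hr : Set.range l = lyndonAtoms W) :
    hilbertSeries (component K W) =
      ∏ i, (1 - (PowerSeries.X : PowerSeries ℚ) ^ (l i).length)⁻¹ := by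
  have hm : ∀ i, 0 < (l i).length := fun i => by
    have : l i ∈ lyndonAtoms W := hr ▸ ⟨i, rfl⟩
    exact List.length_pos_of_ne_nil this.1.1
  ext n
  rw [hilbertSeries, PowerSeries.coeff_mk, finrank_component (nil_mem_normalWords hW),
    ncard_inter_normalWords hW hl hr (· = n),
    Finset.prod_congr rfl fun i _ => PowerSeries.one_sub_X_pow_inv (hm i), PowerSeries.coeff_prod]
  have hprod : ∀ x : Fin s →₀ ℕ, ∏ i, (PowerSeries.coeff (x i))
      (PowerSeries.mk fun n => if (l i).length ∣ n then (1 : ℚ) else 0) =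
      if ∀ i, (l i).length ∣ x i then 1 else 0 := fun x => by
    simp [PowerSeries.coeff_mk, Finset.prod_boole]
  rw [Finset.sum_congr rfl fun x _ => hprod x, Finset.sum_boole, ← Set.ncard_coe_finset]
  -- Exponent vectors `k` correspond to decompositions of `n` whose `i`-th part `k i * |l i|` is
  -- divisible by `|l i|`.
  refine congrArg (Nat.cast (R := ℚ)) (Set.ncard_congr (fun (k : Fin s → ℕ) _ =>
    Finsupp.equivFunOnFinite.symm fun i => k i * (l i).length) ?_ ?_ ?_)
  · intro k hk
    have hk' : ∑ i, k i * (l i).length = n := hk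
    simp [Finset.mem_finsuppAntidiag, hk']
  · intro k k' _ _ h
    funext i
    have := DFunLike.congr_fun h i
    exact Nat.eq_of_mul_eq_mul_right (hm i) this
  · intro f hf
    simp only [Finset.coe_filter, Finset.mem_finsuppAntidiag, Set.mem_ofPred_eq] at hf
    refine ⟨fun i => f i / (l i).length, ?_, ?_⟩
    · change ∑ i, f i / (l i).length * (l i).length = n
      rw [← hf.1.1]
      exact Finset.sum_congr rfl fun i _ => Nat.div_mul_cancel (hf.2 i)
    · ext i
      exact Nat.div_mul_cancel (hf.2 i)

/-! ### Gelfand-Kirillov dimension -/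

section GK

variable {K : Type*} [Field K] {X : Type*} {W : Set (List X)}

/-- The span of the words of length at most `r`. -/
noncomputable def wordFiltration (K : Type*) [Field K] {X : Type*} (W : Set (List X)) (r : ℕ) :
    Submodule K (MonomialAlgebra K W) :=
  Submodule.span K (wordClass K W '' {w | w.length ≤ r})

theorem wordFiltration_mono : Monotone (wordFiltration K W) := fun _ _ h =>
  Submodule.span_mono (Set.image_mono fun _ hw => le_trans hw h)

theorem wordFiltration_mul_le (r t : ℕ) :
    wordFiltration K W r * wordFiltration K W t ≤ wordFiltration K W (r + t) := by
  rw [wordFiltration, wordFiltration, Submodule.span_mul_span, Submodule.span_le]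
  rintro _ ⟨_, ⟨v, hv, rfl⟩, _, ⟨w, hw, rfl⟩, rfl⟩
  refine Submodule.subset_span ⟨v ++ w, ?_, wordClass_append v w⟩
  have hv' : v.length ≤ r := hv
  have hw' : w.length ≤ t := hw
  change (v ++ w).length ≤ r + t
  rw [List.length_append]
  omega

theorem pow_le_wordFiltration {V : Submodule K (MonomialAlgebra K W)} {r : ℕ}
    (h : V ≤ wordFiltration K W r) (i : ℕ) : V ^ i ≤ wordFiltration K W (r * i) := by
  induction i with
  | zero =>
    rw [pow_zero, Submodule.one_eq_span, Submodule.span_singleton_le_iff_mem]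
    exact Submodule.subset_span ⟨[], Nat.zero_le _, wordClass_nil⟩
  | succ i ih =>
    rw [pow_succ, Nat.mul_succ]
    exact (mul_le_mul' ih h).trans (wordFiltration_mul_le _ _)

theorem wordFiltration_fg [Finite X] (r : ℕ) : (wordFiltration K W r).FG :=
  Submodule.fg_span ((List.finite_length_le X r).image _)

theorem exists_le_wordFiltration {V : Submodule K (MonomialAlgebra K W)} (hV : V.FG) :
    ∃ r, V ≤ wordFiltration K W r := by
  have hmem : ∀ a : MonomialAlgebra K W, ∃ r, a ∈ wordFiltration K W r := by
    intro a
    have ha : a ∈ Submodule.span K (Set.range (wordClass K W)) := by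
      rw [span_range_wordClass]
      trivial
    induction ha using Submodule.span_induction with
    | mem a h =>
      obtain ⟨w, rfl⟩ := h
      exact ⟨w.length, Submodule.subset_span ⟨w, le_refl w.length, rfl⟩⟩
    | zero => exact ⟨0, zero_mem _⟩
    | add a b _ _ ha hb =>
      obtain ⟨r, hr⟩ := ha
      obtain ⟨t, ht⟩ := hb
      exact ⟨max r t, add_mem (wordFiltration_mono (le_max_left r t) hr)
        (wordFiltration_mono (le_max_right r t) ht)⟩
    | smul c a _ ha =>
      obtain ⟨r, hr⟩ := ha
      exact ⟨r, Submodule.smul_mem _ _ hr⟩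
  choose r hr using hmem
  obtain ⟨F, rfl⟩ := hV
  refine ⟨F.sup r, Submodule.span_le.2 fun a ha => wordFiltration_mono (Finset.le_sup ha) (hr a)⟩

theorem wordFiltration_le_iSup_pow (n : ℕ) :
    wordFiltration K W n ≤ ⨆ i : Fin (n + 1), wordFiltration K W 1 ^ (i : ℕ) := by
  have hmem : ∀ w : List X, wordClass K W w ∈ wordFiltration K W 1 ^ w.length := by
    intro w
    induction w with
    | nil =>
      rw [wordClass_nil, List.length_nil, pow_zero]
      exact Submodule.one_le.1 le_rfl
    | cons x w ih =>
      rw [List.length_cons, pow_succ', ← List.singleton_append, wordClass_append]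
      exact Submodule.mul_mem_mul (Submodule.subset_span ⟨[x], by simp, rfl⟩) ih
  refine Submodule.span_le.2 ?_
  rintro _ ⟨w, hw, rfl⟩
  have hw' : w.length ≤ n := hw
  exact Submodule.mem_iSup_of_mem (⟨w.length, by omega⟩ : Fin (n + 1)) (hmem w)

theorem finrank_wordFiltration [Finite X] [LinearOrder X] (hW : ∀ w ∈ W, IsLyndon w)
    {s : ℕ} {l : Fin s → List X} (hl : StrictAnti l) (hr : Set.range l = lyndonAtoms W) (r : ℕ) :
    Module.finrank K (wordFiltration K W r) =
      {k : Fin s → ℕ | ∑ i, k i * (l i).length ≤ r}.ncard := by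
  rw [wordFiltration, finrank_span_wordClass (nil_mem_normalWords hW) (List.finite_length_le X r),
    ncard_inter_normalWords hW hl hr (· ≤ r)]

theorem tendsto_const_div_log (a : ℝ) :
    Filter.Tendsto (fun n : ℕ => a / Real.log n) Filter.atTop (nhds 0) :=
  (Real.tendsto_log_atTop.comp tendsto_natCast_atTop_atTop).const_div_atTop a

theorem limsup_coe_le_of_le {u v : ℕ → ℝ} {d : ℝ} (h : ∀ᶠ n in Filter.atTop, u n ≤ v n)
    (hv : Filter.Tendsto v Filter.atTop (nhds d)) :
    Filter.limsup (fun n => (u n : EReal)) Filter.atTop ≤ (d : EReal) := by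
  rw [← ((continuous_coe_real_ereal.tendsto d).comp hv).limsup_eq]
  exact Filter.limsup_le_limsup (h.mono fun n hn => EReal.coe_le_coe_iff.2 hn)

theorem le_limsup_coe_of_le {u v : ℕ → ℝ} {d : ℝ} (h : ∀ᶠ n in Filter.atTop, v n ≤ u n)
    (hv : Filter.Tendsto v Filter.atTop (nhds d)) :
    (d : EReal) ≤ Filter.limsup (fun n => (u n : EReal)) Filter.atTop := by
  rw [← ((continuous_coe_real_ereal.tendsto d).comp hv).limsup_eq]
  exact Filter.limsup_le_limsup (h.mono fun n hn => EReal.coe_le_coe_iff.2 hn)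

/-- Any `V` lies in some filtration step `r`, so its powers up to `n` span at most `((r + 1) n) ^ s`
dimensions; the words of length at most one attain at least `(n / Λ) ^ s`. The constants vanish
after division by `log n`. -/
theorem gkDim_eq [Finite X] [LinearOrder X] (hW : ∀ w ∈ W, IsLyndon w)
    {s : ℕ} {l : Fin s → List X} (hl : StrictAnti l) (hr : Set.range l = lyndonAtoms W) :
    gkDim K (MonomialAlgebra K W) = (s : EReal) := by
  have hm : ∀ i, 0 < (l i).length := fun i => by
    have : l i ∈ lyndonAtoms W := hr ▸ ⟨i, rfl⟩
    exact List.length_pos_of_ne_nil this.1.1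
  have hcast : ((s : ℝ) : EReal) = (s : EReal) := by simp
  have hlog : ∀ n : ℕ, 2 ≤ n → 0 < Real.log n := fun n hn =>
    Real.log_pos (by exact_mod_cast hn)
  refine le_antisymm (iSup₂_le fun V hV => ?_) ?_
  · obtain ⟨r, hVr⟩ := exists_le_wordFiltration hV
    rw [← hcast]
    refine limsup_coe_le_of_le (v := fun n : ℕ => s * (Real.log (r + 1) / Real.log n + 1))
      (Filter.eventually_atTop.2 ⟨2, fun n hn => ?_⟩) ?_
    · have hle : (⨆ i : Fin (n + 1), V ^ (i : ℕ) : Submodule K (MonomialAlgebra K W)) ≤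
          wordFiltration K W (r * n) :=
        iSup_le fun i => (pow_le_wordFiltration hVr i).trans
          (wordFiltration_mono (Nat.mul_le_mul_left r (Nat.lt_succ_iff.1 i.2)))
      have := Module.Finite.iff_fg.2 (wordFiltration_fg (K := K) (W := W) (r * n))
      have h1 := (Submodule.finrank_mono hle).trans_eq (finrank_wordFiltration hW hl hr (r * n))
      have h2 := h1.trans (ncard_setOf_sum_mul_le hm (r * n))
      have h3 := hlog n hn
      have hn0 : (0 : ℝ) < n := by exact_mod_cast (by omega : 0 < n)
      have h4 : (r * n + 1) ^ s ≤ ((r + 1) * n) ^ s := Nat.pow_le_pow_left (by nlinarith) s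
      have h5 : ((Module.finrank K
          (⨆ i : Fin (n + 1), V ^ (i : ℕ) : Submodule K (MonomialAlgebra K W)) : ℕ) : ℝ) ≤
          ((r + 1) * n : ℝ) ^ s := by exact_mod_cast h2.trans h4
      have h6 : 0 ≤ Real.log ((r : ℝ) + 1) := Real.log_nonneg (by simp)
      rw [div_le_iff₀ h3]
      have h7 : s * (Real.log (r + 1) / Real.log n + 1) * Real.log n =
          s * (Real.log (r + 1) + Real.log n) := by
        field_simp
      rw [h7]
      -- Monotonicity of the logarithm needs a positive argument; at zero the default `Real.log 0 =
      -- 0` does.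
      rcases Nat.eq_zero_or_pos (Module.finrank K
          (⨆ i : Fin (n + 1), V ^ (i : ℕ) : Submodule K (MonomialAlgebra K W))) with h0 | h0
      · rw [h0]
        simp only [Nat.cast_zero, Real.log_zero]
        positivity
      · refine (Real.log_le_log (by exact_mod_cast h0) h5).trans_eq ?_
        rw [Real.log_pow, Real.log_mul (by positivity) hn0.ne']
    · have := ((tendsto_const_div_log (Real.log (r + 1))).add_const 1).const_mul (s : ℝ)
      simpa using this
  · refine le_trans ?_ (le_iSup₂ (wordFiltration K W 1) (wordFiltration_fg 1))
    rw [← hcast]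
    -- The `+ 1` keeps `Λ` positive when there are no atoms.
    set Λ := (∑ i, (l i).length) + 1 with hΛ
    have hΛ0 : (0 : ℝ) < Λ := by positivity
    refine le_limsup_coe_of_le (v := fun n : ℕ => s * (1 - Real.log Λ / Real.log n))
      (Filter.eventually_atTop.2 ⟨2, fun n hn => ?_⟩) ?_
    · have hfg : (⨆ i : Fin (n + 1), wordFiltration K W 1 ^ (i : ℕ) :
          Submodule K (MonomialAlgebra K W)).FG :=
        Submodule.fg_iSup _ fun i => (wordFiltration_fg 1).pow i
      have := Module.Finite.iff_fg.2 hfg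
      have h1 := Submodule.finrank_mono (wordFiltration_le_iSup_pow (K := K) (W := W) n)
      rw [finrank_wordFiltration hW hl hr n] at h1
      have h2 : (n / Λ + 1) ^ s ≤ {k : Fin s → ℕ | ∑ i, k i * (l i).length ≤ n}.ncard := by
        have h := Set.ncard_le_ncard (t := {k : Fin s → ℕ | ∑ i, k i * (l i).length ≤ n})
          (fun k hk => by
            have h3 := piFinset_subset_setOf_sum_mul_le (fun i => (l i).length) (n / Λ) hk
            have h4 : n / Λ * ∑ i, (l i).length ≤ n :=
              (Nat.mul_le_mul_left _ (by omega)).trans (Nat.div_mul_le_self n Λ)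
            exact le_trans h3 h4) (finite_setOf_sum_mul_le hm n)
        rw [Set.ncard_coe_finset] at h
        simpa using h
      have h3 : (n : ℝ) / Λ ≤ ((n / Λ + 1 : ℕ) : ℝ) := by
        rw [div_le_iff₀ hΛ0]
        have := Nat.lt_div_mul_add (a := n) (b := Λ) (Nat.succ_pos _)
        have h' : n ≤ (n / Λ + 1) * Λ := by rw [add_mul, one_mul]; exact this.le
        exact_mod_cast h'
      have hn0 : (0 : ℝ) < n := by exact_mod_cast (by omega : 0 < n)
      have h4 : ((n : ℝ) / Λ) ^ s ≤ ((Module.finrank K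
          (⨆ i : Fin (n + 1), wordFiltration K W 1 ^ (i : ℕ) :
            Submodule K (MonomialAlgebra K W)) : ℕ) : ℝ) :=
        (pow_le_pow_left₀ (by positivity) h3 s).trans (by exact_mod_cast h2.trans h1)
      have h5 := hlog n hn
      rw [le_div_iff₀ h5]
      refine le_trans (le_of_eq ?_) (Real.log_le_log (by positivity) h4)
      rw [Real.log_pow, Real.log_div hn0.ne' hΛ0.ne']
      field_simp
    · have := ((tendsto_const_div_log (Real.log Λ)).const_sub 1).const_mul (s : ℝ)
      simpa using this

end GK

/-! ### Polynomial identities -/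

section PI

variable {K : Type*} [Field K]

/-- The standard polynomial `∑ sign σ * v (σ 1) * ⋯ * v (σ n)`. -/
def standardPolynomial {A : Type*} [Ring A] {n : ℕ} (v : Fin n → A) : A :=
  ∑ σ : Equiv.Perm (Fin n), Equiv.Perm.sign σ • (List.ofFn fun i => v (σ i)).prod

theorem map_standardPolynomial {A B : Type*} [Ring A] [Ring B] [Algebra K A] [Algebra K B]
    (φ : A →ₐ[K] B) {n : ℕ} (v : Fin n → A) :
    φ (standardPolynomial v) = standardPolynomial (fun i => φ (v i)) := by
  simp only [standardPolynomial, map_sum, Units.smul_def, map_zsmul, map_list_prod, List.map_ofFn]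
  rfl

/-- An alternating map in `n² + 1` arguments vanishes on a free module of rank `n²`: basis vectors
must repeat. -/
theorem standardPolynomial_matrix_eq_zero {C : Type*} [CommRing C] (n : ℕ)
    (v : Fin (n * n + 1) → Matrix (Fin n) (Fin n) C) : standardPolynomial v = 0 := by
  have h : MultilinearMap.alternatization
      (MultilinearMap.mkPiAlgebraFin C (n * n + 1) (Matrix (Fin n) (Fin n) C)) = 0 := by
    refine Module.Basis.ext_alternating (Matrix.stdBasis C (Fin n) (Fin n)) fun v hv => ?_
    have := Fintype.card_le_of_injective v hv
    simp at this
  have := DFunLike.congr_fun h v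
  simpa [MultilinearMap.alternatization_apply, standardPolynomial,
    MultilinearMap.mkPiAlgebraFin_apply] using this

/-- In the monomial algebra without relations, only the identity permutation contributes to the
coefficient of the word `0 1 ⋯ (n - 1)`. -/
theorem standardPolynomial_ι_ne_zero (n : ℕ) :
    standardPolynomial (fun i : Fin n => FreeAlgebra.ι K (i : ℕ)) ≠ 0 := by
  classical
  intro h
  have h0 : [] ∈ normalWords (∅ : Set (List ℕ)) := by simp [normalWords]
  have h1 := congrArg (FreeAlgebra.lift K fun i : ℕ => wordClass K (∅ : Set (List ℕ)) [i]) h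
  rw [map_standardPolynomial, map_zero] at h1
  have h2 : ∀ σ : Equiv.Perm (Fin n),
      (List.ofFn fun i => FreeAlgebra.lift K (fun i : ℕ => wordClass K (∅ : Set (List ℕ)) [i])
        (FreeAlgebra.ι K (σ i : ℕ))).prod =
      wordClass K (∅ : Set (List ℕ)) (List.ofFn fun i => (σ i : ℕ)) := by
    intro σ
    have : List.ofFn (fun i => (σ i : ℕ)) = (List.ofFn fun i => [(σ i : ℕ)]).flatten := by
      rw [← List.flatMap_singleton' (List.ofFn fun i => (σ i : ℕ)), List.flatMap, List.map_ofFn]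
      rfl
    rw [this, wordClass_flatten, List.map_ofFn]
    congr 2
    funext i
    simp
  simp only [standardPolynomial, h2] at h1
  have h3 := congrArg (fun a => normalForm K h0 a (List.ofFn fun i : Fin n => (i : ℕ))) h1
  simp only [Units.smul_def, map_sum, map_zsmul, normalForm_wordClass, map_zero, Finsupp.coe_zero,
    Pi.zero_apply, Finsupp.finsetSum_apply] at h3
  rw [Finset.sum_eq_single 1] at h3
  · simp [normalWords] at h3
  · intro σ _ hσ
    have hne : List.ofFn (fun i => (σ i : ℕ)) ≠ List.ofFn fun i : Fin n => (i : ℕ) := by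
      intro he
      refine hσ (Equiv.ext fun i => Fin.ext ?_)
      exact congrFun (List.ofFn_injective he) i
    simp [normalWords, Finsupp.single_eq_of_ne hne.symm]
  · simp

theorem isPIAlgebra_of_embedsInMatrixOverCommRing {A : Type*} [Ring A] [Algebra K A]
    (h : EmbedsInMatrixOverCommRing K A) : IsPIAlgebra K A := by
  obtain ⟨C, _, _, n, φ, hφ⟩ := h
  refine ⟨_, standardPolynomial_ι_ne_zero (n * n + 1), fun g => hφ ?_⟩
  rw [map_standardPolynomial, map_standardPolynomial, standardPolynomial_matrix_eq_zero, map_zero]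

theorem embedsInMatrixOverCommRing_of_field {A : Type*} [Ring A] [Algebra K A]
    (h : EmbedsInMatrixOverField K A) : EmbedsInMatrixOverCommRing K A := by
  obtain ⟨L, _, _, n, φ, hφ⟩ := h
  exact ⟨L, inferInstance, inferInstance, n, φ, hφ⟩

/-- The product of sums of letters along a word, expanded. -/
theorem List.prod_map_sum_filter {A ι : Type*} [Ring A] [Algebra K A] [Fintype ι]
    [DecidableEq ι] (S : ℕ → Finset ι) (y : ι → A) (m : List ℕ) :
    (m.map fun i => ∑ j ∈ S i, y j).prod =
      ∑ r ∈ Fintype.piFinset fun t : Fin m.length => S (m.get t),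
        (List.ofFn fun t => y (r t)).prod := by
  have h := (MultilinearMap.mkPiAlgebraFin K m.length A).map_sum_finset
    (fun _ j => y j) (fun t : Fin m.length => S (m.get t))
  simp only [MultilinearMap.mkPiAlgebraFin_apply] at h
  rw [← h]
  congr 1
  conv_lhs => rw [← List.ofFn_get m, List.map_ofFn]
  rfl

theorem finite_of_isPIAlgebra {X : Type*} [LinearOrder X] {W : Set (List X)}
    (hW : ∀ w ∈ W, IsLyndon w) (hPI : IsPIAlgebra K (MonomialAlgebra K W)) :
    (lyndonAtoms W).Finite := by
  classical
  by_contra hinf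
  obtain ⟨f, hf, hzero⟩ := hPI
  have hspan : f ∈ Submodule.span K (Set.range (monomialOfWord K (X := ℕ))) := by
    rw [span_range_monomialOfWord]
    trivial
  obtain ⟨c, rfl⟩ := Finsupp.mem_span_range_iff_exists_finsupp.1 hspan
  have hc : c.support.Nonempty := by
    rw [Finsupp.support_nonempty_iff]
    rintro rfl
    simp at hf
  obtain ⟨m₀, hm₀, hmax⟩ := Finset.exists_max_image c.support List.length hc
  obtain ⟨l, hl, hatom⟩ : ∃ l : Fin m₀.length → List X, StrictAnti l ∧
      ∀ i, l i ∈ lyndonAtoms W := by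
    obtain ⟨F, hF, hcard⟩ := Set.Infinite.exists_subset_card_eq hinf m₀.length
    obtain ⟨l, hl, hr⟩ := exists_strictAnti_range_eq F
    rw [← hcard]
    exact ⟨l, hl, fun i => hF (hr ▸ ⟨i, rfl⟩)⟩
  have hchain : IsLyndonChain (List.ofFn l) := by
    refine ⟨fun w hw => ?_, List.pairwise_ofFn.2 fun i j hij => (hl hij).le⟩
    obtain ⟨i, rfl⟩ := (List.mem_ofFn' _ _).1 hw
    exact (hatom i).1
  have hnormal : (List.ofFn l).flatten ∈ normalWords W := by
    refine hchain.flatten_mem_normalWords hW fun w hw => ?_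
    obtain ⟨i, rfl⟩ := (List.mem_ofFn' _ _).1 hw
    exact hatom i
  have h0 := nil_mem_normalWords hW
  have hev : ∀ w, normalForm K h0 (wordClass K W w) (List.ofFn l).flatten =
      if w = (List.ofFn l).flatten then 1 else 0 := by
    intro w
    rw [normalForm_wordClass]
    by_cases hw : w = (List.ofFn l).flatten
    · rw [if_pos hw, hw, if_pos hnormal, Finsupp.single_eq_same]
    · rw [if_neg hw]
      split_ifs
      · exact Finsupp.single_eq_of_ne (Ne.symm hw)
      · rfl
  have hinj : ∀ m : List ℕ, m.length ≤ m₀.length → ∀ r : Fin m.length → Fin m₀.length,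
      (List.ofFn fun t => l (r t)).flatten = (List.ofFn l).flatten →
        List.ofFn r = List.ofFn id := by
    intro m hm r h
    have h1 : List.ofFn (fun t => l (r t)) = List.ofFn l := by
      refine hchain.eq_of_length_le (fun w hw => ?_) (by simpa using hm) h
      obtain ⟨i, rfl⟩ := (List.mem_ofFn' _ _).1 hw
      exact (hatom _).1
    refine List.map_injective_iff.2 hl.injective ?_
    rw [List.map_ofFn, List.map_ofFn]
    exact h1
  -- Sending a variable to the sum of the atoms at all its positions in `m₀` lets a repeated
  -- variable stand for different atoms, so the identity need not be multilinear.
  set g : ℕ → MonomialAlgebra K W := fun i =>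
    ∑ j ∈ Finset.univ.filter (fun j => m₀.get j = i), wordClass K W (l j) with hg
  have hcoeff : ∀ m : List ℕ, m.length ≤ m₀.length →
      normalForm K h0 (m.map g).prod (List.ofFn l).flatten = if m = m₀ then 1 else 0 := by
    intro m hm
    rw [hg, List.prod_map_sum_filter (K := K)]
    have hword : ∀ r : Fin m.length → Fin m₀.length,
        (List.ofFn fun t => wordClass K W (l (r t))).prod =
          wordClass K W (List.ofFn fun t => l (r t)).flatten := by
      intro r
      rw [wordClass_flatten, List.map_ofFn]
      rfl
    simp only [hword, map_sum, Finsupp.finsetSum_apply, hev]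
    split_ifs with hmm
    · subst hmm
      rw [Finset.sum_eq_single id]
      · simp
      · intro r _ hr
        rw [if_neg]
        exact fun h => hr (List.ofFn_injective (hinj m hm r h))
      · intro h
        exact absurd (by simp [Fintype.mem_piFinset]) h
    -- A contributing choice `r` must be the identity on positions, and then the letters of `m` and
    -- `m₀` agree one by one.
    · refine Finset.sum_eq_zero fun r hr => if_neg fun h => hmm ?_
      have h1 := congrArg (List.map m₀.get) (hinj m hm r h)
      rw [List.map_ofFn, List.map_ofFn, Function.comp_id, List.ofFn_get] at h1
      rw [← h1]
      conv_lhs => rw [← List.ofFn_get m]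
      congr 1
      funext t
      have := (Fintype.mem_piFinset.1 hr) t
      exact (Finset.mem_filter.1 this).2.symm
  have h1 := congrArg (fun a => normalForm K h0 a (List.ofFn l).flatten) (hzero g)
  simp only [Finsupp.sum, map_sum, map_smul, lift_monomialOfWord, map_zero, Finsupp.coe_zero,
    Pi.zero_apply, Finsupp.finsetSum_apply, Finsupp.smul_apply] at h1
  rw [Finset.sum_congr rfl fun m hm => by rw [hcoeff m (hmax m hm)]] at h1
  simp only [smul_eq_mul, mul_ite, mul_one, mul_zero, Finset.sum_ite_eq', if_pos hm₀] at h1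
  exact (Finsupp.mem_support_iff.1 hm₀) h1

end PI

/-! ### Matrix representations -/

section Matrices

open Matrix

variable {K : Type*} [Field K] {X : Type*} {W : Set (List X)}

theorem injective_of_linearIndependent_comp {V : Type*} [AddCommGroup V] [Module K V]
    (ψ : MonomialAlgebra K W →ₗ[K] V)
    (h : LinearIndependent K fun w : normalWords W => ψ (wordClass K W w)) :
    Function.Injective ψ := by
  rw [injective_iff_map_eq_zero]
  intro a ha
  have hspan : a ∈ Submodule.span K (Set.range fun w : normalWords W => wordClass K W w) := by
    rw [← Set.image_eq_range (wordClass K W), span_wordClass_normalWords]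
    trivial
  obtain ⟨c, rfl⟩ := Finsupp.mem_span_range_iff_exists_finsupp.1 hspan
  have hc : c = 0 := by
    refine linearIndependent_iff.1 h c ?_
    rw [Finsupp.linearCombination_apply, ← ha, map_finsuppSum]
    simp
  simp [hc]

/-- The initial segment of length at most `M` of a word. -/
def wordWindow (M : ℕ) (w : List X) : {w : List X // w.length ≤ M} :=
  ⟨w.take M, by simp⟩

/-- Windows behave like states of a finite automaton: the next one depends only on the current one
and the letter. -/
theorem wordWindow_cons_wordWindow (M : ℕ) (x : X) (w : List X) :
    wordWindow M (x :: (wordWindow M w).1) = wordWindow M (x :: w) := by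
  apply Subtype.ext
  cases M with
  | zero => rfl
  | succ M => simp [wordWindow, List.take_take]

variable [LinearOrder X]

/-- The exponents of the Lyndon words `l i` in the Lyndon factorization of a word. -/
noncomputable def lyndonExponent {s : ℕ} (l : Fin s → List X) (w : List X) : Fin s →₀ ℕ :=
  Finsupp.equivFunOnFinite.symm fun i => (lyndonFactors w).count (l i)

theorem lyndonExponent_nil {s : ℕ} (l : Fin s → List X) : lyndonExponent l [] = 0 := by
  ext i
  simp [lyndonExponent, lyndonFactors]

/-- This is `lyndonFactors_cons` after counting, in additive form to avoid truncated subtraction. -/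
theorem lyndonExponent_cons {s : ℕ} (l : Fin s → List X) (x : X) (w : List X) :
    lyndonExponent l (x :: w) + lyndonExponent l (lyndonHead (x :: w)).tail =
      lyndonExponent l (lyndonHead (x :: w)) + lyndonExponent l w := by
  obtain ⟨L₁, L₂, h₁, h₂, h₃⟩ := lyndonFactors_cons x w
  have hc : IsLyndonChain [lyndonHead (x :: w)] :=
    isLyndonChain_nil.cons (lyndonHead_cons x w).1 (by simp)
  have h₄ := hc.lyndonFactors_flatten
  simp only [List.flatten_cons, List.flatten_nil, List.append_nil] at h₄
  ext i
  simp only [lyndonExponent, Finsupp.add_apply, Finsupp.equivFunOnFinite_symm_apply_apply]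
  rw [h₁, h₂, h₃, h₄, ← List.singleton_append, List.count_append, List.count_append]
  omega

theorem lyndonExponent_injOn {s : ℕ} {l : Fin s → List X} (hl : StrictAnti l)
    (hr : Set.range l = lyndonAtoms W) : Set.InjOn (lyndonExponent l) (normalWords W) := by
  intro v hv w hw h
  have hpow : ∀ u ∈ normalWords W, lyndonFactors u = powList l (lyndonExponent l u) := by
    intro u hu
    refine (isLyndonChain_lyndonFactors u).eq_powList hl (fun i => ?_) fun a ha => ?_
    · exact (hr ▸ ⟨i, rfl⟩ : l i ∈ lyndonAtoms W).1
    · have := mem_lyndonAtoms_of_mem_lyndonFactors hu ha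
      rwa [← hr] at this
  rw [← flatten_lyndonFactors v, hpow v hv, h, ← hpow w hw, flatten_lyndonFactors]

/-- The monomial recording the exponents of a word, in the field of rational functions. -/
noncomputable def lyndonMonomial (K : Type*) [Field K] {s : ℕ} (l : Fin s → List X)
    (w : List X) : FractionRing (MvPolynomial (Fin s) K) :=
  algebraMap (MvPolynomial (Fin s) K) _ (MvPolynomial.monomial (lyndonExponent l w) 1)

theorem lyndonMonomial_ne_zero {s : ℕ} (l : Fin s → List X) (w : List X) :
    lyndonMonomial K l w ≠ 0 := by
  rw [lyndonMonomial, Ne, FaithfulSMul.algebraMap_eq_zero_iff, MvPolynomial.monomial_eq_zero]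
  exact one_ne_zero

theorem lyndonMonomial_nil {s : ℕ} (l : Fin s → List X) : lyndonMonomial K l [] = 1 := by
  rw [lyndonMonomial, lyndonExponent_nil]
  exact map_one _

/-- The ratio is the weight of prepending `x`. Merging removes factors, so negative exponents can
occur and fractions are needed. -/
theorem lyndonMonomial_cons {s : ℕ} (l : Fin s → List X) (x : X) (w : List X) :
    lyndonMonomial K l (lyndonHead (x :: w)) / lyndonMonomial K l (lyndonHead (x :: w)).tail *
      lyndonMonomial K l w = lyndonMonomial K l (x :: w) := by
  rw [div_mul_eq_mul_div, div_eq_iff (lyndonMonomial_ne_zero _ _)]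
  simp only [lyndonMonomial, ← map_mul, MvPolynomial.monomial_mul, mul_one]
  rw [lyndonExponent_cons]

theorem linearIndependent_lyndonMonomial {s : ℕ} {l : Fin s → List X} (hl : StrictAnti l)
    (hr : Set.range l = lyndonAtoms W) :
    LinearIndependent K fun w : normalWords W => lyndonMonomial K l w := by
  have h1 : LinearIndependent K fun w : normalWords W =>
      (MvPolynomial.monomial (lyndonExponent l (w : List X)) 1 : MvPolynomial (Fin s) K) := by
    have := (MvPolynomial.basisMonomials (Fin s) K).linearIndependent.comp
      (fun w : normalWords W => lyndonExponent l (w : List X))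
      fun v w h => Subtype.ext (lyndonExponent_injOn hl hr v.2 w.2 h)
    simpa [Function.comp_def] using this
  exact h1.map' (IsScalarTower.toAlgHom K (MvPolynomial (Fin s) K)
    (FractionRing (MvPolynomial (Fin s) K))).toLinearMap
    (LinearMap.ker_eq_bot.2 (FaithfulSMul.algebraMap_injective _ _))

open Classical in
/-- The matrix of a letter, acting on the initial segments of length at most `M`. -/
noncomputable def letterMatrix (K : Type*) [Field K] (W : Set (List X)) {s : ℕ}
    (l : Fin s → List X) (M : ℕ) (x : X) :
    Matrix {w : List X // w.length ≤ M} {w : List X // w.length ≤ M}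
      (FractionRing (MvPolynomial (Fin s) K)) :=
  fun v w => if x :: w.1 ∈ normalWords W ∧ v = wordWindow M (x :: w.1) then
    lyndonMonomial K l (lyndonHead (x :: w.1)) / lyndonMonomial K l (lyndonHead (x :: w.1)).tail
  else 0

variable {s : ℕ} (l : Fin s → List X) (M : ℕ)
  [Fintype {w : List X // w.length ≤ M}]

open Classical in
theorem letterMatrix_mulVec_single (x : X) (w : {w : List X // w.length ≤ M})
    (b : FractionRing (MvPolynomial (Fin s) K)) :
    letterMatrix K W l M x *ᵥ Pi.single w b = if x :: w.1 ∈ normalWords W then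
      Pi.single (wordWindow M (x :: w.1)) (lyndonMonomial K l (lyndonHead (x :: w.1)) /
        lyndonMonomial K l (lyndonHead (x :: w.1)).tail * b) else 0 := by
  ext v
  rw [Matrix.mulVec_single]
  by_cases h : x :: w.1 ∈ normalWords W
  · by_cases hv : v = wordWindow M (x :: w.1)
    · simp [letterMatrix, h, hv]
    · simp [letterMatrix, h, hv]
  · simp [letterMatrix, h]

/-- For vanishing only the window reached matters, so the coefficient is left unspecified and may be
zero. -/
theorem exists_letterMatrix_prod_mulVec_single (v : List X) (w : {w : List X // w.length ≤ M})
    (b : FractionRing (MvPolynomial (Fin s) K)) :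
    ∃ c, (v.map (letterMatrix K W l M)).prod *ᵥ Pi.single w b =
      Pi.single (wordWindow M (v ++ w.1)) c := by
  induction v with
  | nil =>
    refine ⟨b, ?_⟩
    have : wordWindow M w.1 = w := Subtype.ext (List.take_of_length_le w.2)
    rw [List.map_nil, List.prod_nil, Matrix.one_mulVec, List.nil_append, this]
  | cons x v ih =>
    obtain ⟨c, hc⟩ := ih
    rw [List.map_cons, List.prod_cons, ← Matrix.mulVec_mulVec, hc, letterMatrix_mulVec_single,
      wordWindow_cons_wordWindow]
    split_ifs
    · exact ⟨_, rfl⟩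
    · exact ⟨0, by simp⟩

/-- The first letter of `u` acts last, on a window that still shows the rest of `u` because `u` has
length at most `M`; the completed `u` is then detected. -/
theorem letterMatrix_prod_eq_zero (h0 : [] ∈ normalWords W) {u : List X} (hu : u ∈ W)
    (hlen : u.length ≤ M) : (u.map (letterMatrix K W l M)).prod = 0 := by
  classical
  cases u with
  | nil => exact absurd List.infix_rfl (h0 _ hu)
  | cons x u =>
    refine Matrix.ext_of_mulVec_single fun w => ?_
    obtain ⟨c, hc⟩ := exists_letterMatrix_prod_mulVec_single (K := K) (W := W) l M u w 1
    rw [List.map_cons, List.prod_cons, ← Matrix.mulVec_mulVec, hc, letterMatrix_mulVec_single,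
      if_neg, Matrix.zero_mulVec]
    intro h
    refine h _ hu (List.IsPrefix.isInfix ((List.prefix_cons_inj x).2 ?_))
    rw [List.length_cons] at hlen
    exact List.prefix_take_iff.2 ⟨List.prefix_append u w.1, by omega⟩

/-- The weights telescope to the monomial of the whole word. The window gives the right weight
because the new first factor is an atom, hence of length at most `M`. -/
theorem letterMatrix_prod_mulVec_nil (hM : ∀ a ∈ lyndonAtoms W, a.length ≤ M) {w : List X}
    (hw : w ∈ normalWords W) :
    (w.map (letterMatrix K W l M)).prod *ᵥ Pi.single (wordWindow M []) 1 =
      Pi.single (wordWindow M w) (lyndonMonomial K l w) := by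
  classical
  induction w with
  | nil => rw [List.map_nil, List.prod_nil, Matrix.one_mulVec, lyndonMonomial_nil]
  | cons x w ih =>
    have hpre : (wordWindow M w).1 <+: w := List.take_prefix M w
    have hnormal : x :: (wordWindow M w).1 ∈ normalWords W :=
      normalWords_of_infix hw ((List.prefix_cons_inj x).2 hpre).isInfix
    obtain ⟨h1, h2, -⟩ := lyndonHead_cons x w
    have hlen : (lyndonHead (x :: w)).length ≤ (wordWindow M w).1.length + 1 := by
      have h3 := hM _ ⟨h1, normalWords_of_infix hw h2.isInfix⟩
      have h4 := h2.length_le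
      rw [List.length_cons] at h4
      change _ ≤ (w.take M).length + 1
      rw [List.length_take]
      omega
    rw [List.map_cons, List.prod_cons, ← Matrix.mulVec_mulVec,
      ih (normalWords_of_infix hw (List.suffix_cons x w).isInfix), letterMatrix_mulVec_single,
      if_pos hnormal, wordWindow_cons_wordWindow, lyndonHead_eq_of_prefix hpre hlen,
      lyndonMonomial_cons]

theorem embedsInMatrixOverField_of_finite [Finite X] (hW : ∀ w ∈ W, IsLyndon w)
    (hanti : IsAntichain (fun u w : List X => u <:+: w) W) (hfin : (lyndonAtoms W).Finite) :
    EmbedsInMatrixOverField K (MonomialAlgebra K W) := by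
  classical
  obtain ⟨M, hM, hM'⟩ := exists_length_bound hW hanti hfin
  obtain ⟨s, l, hl, hr⟩ : ∃ (s : ℕ) (l : Fin s → List X), StrictAnti l ∧
      Set.range l = hfin.toFinset := ⟨_, exists_strictAnti_range_eq hfin.toFinset⟩
  rw [hfin.coe_toFinset] at hr
  have : Finite {w : List X // w.length ≤ M} := List.finite_length_le X M
  have := Fintype.ofFinite {w : List X // w.length ≤ M}
  have h0 := nil_mem_normalWords hW
  let φ := MonomialAlgebra.lift (K := K) (letterMatrix K W l M)
    fun u hu => letterMatrix_prod_eq_zero l M h0 hu (hM' u hu)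
  have hφ : Function.Injective φ := by
    -- Summing the coordinates of the column of the empty window forgets the window reached and
    -- keeps the monomial, which identifies the normal word.
    let ψ : MonomialAlgebra K W →ₗ[K] FractionRing (MvPolynomial (Fin s) K) :=
      { toFun := fun a => ∑ i, (φ a *ᵥ Pi.single (wordWindow M []) 1) i
        map_add' := fun a b => by simp [Finset.sum_add_distrib]
        map_smul' := fun c a => by simp [Finset.smul_sum] }
    have hψ : Function.Injective ψ := by
      refine injective_of_linearIndependent_comp ψ ?_
      have : (fun w : normalWords W => ψ (wordClass K W w)) =
          fun w : normalWords W => lyndonMonomial K l w := by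
        funext w
        change ∑ i, (φ (wordClass K W w) *ᵥ Pi.single (wordWindow M []) 1) i = _
        rw [MonomialAlgebra.lift_wordClass, letterMatrix_prod_mulVec_nil l M hM w.2]
        simp
      rw [this]
      exact linearIndependent_lyndonMonomial hl hr
    intro a b hab
    refine hψ ?_
    change ∑ i, (φ a *ᵥ Pi.single (wordWindow M []) 1) i =
      ∑ i, (φ b *ᵥ Pi.single (wordWindow M []) 1) i
    rw [hab]
  let e := Fintype.equivFin {w : List X // w.length ≤ M}
  refine ⟨FractionRing (MvPolynomial (Fin s) K), inferInstance, inferInstance, _,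
    (Matrix.reindexAlgEquiv K (FractionRing (MvPolynomial (Fin s) K)) e).toAlgHom.comp φ, ?_⟩
  exact (Matrix.reindexAlgEquiv K (FractionRing (MvPolynomial (Fin s) K)) e).injective.comp hφ

end Matrices

theorem theoremA {K : Type*} [Field K] {X : Type*} [Finite X] [LinearOrder X]
    (W : Set (List X)) (hLyndon : ∀ w ∈ W, IsLyndon w)
    (hAntichain : IsAntichain (fun u w : List X => u <:+: w) W) :
    -- the normal words are the products of powers of a decreasing sequence of atoms
    normalWords W =
      {w | ∃ (s : ℕ) (l : Fin s → List X) (k : Fin s → ℕ),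
        StrictAnti l ∧ (∀ i, l i ∈ lyndonAtoms W) ∧ w = powProd l k} ∧
    -- the normal words form a basis
    (LinearIndependent K (fun w : normalWords W => wordClass K W w) ∧
      Submodule.span K (wordClass K W '' normalWords W) = ⊤) ∧
    -- the equivalences
    List.TFAE [
      (lyndonAtoms W).Finite,
      HasPolynomialGrowth (component K W),
      IsPIAlgebra K (MonomialAlgebra K W),
      EmbedsInMatrixOverField K (MonomialAlgebra K W),
      EmbedsInMatrixOverCommRing K (MonomialAlgebra K W)] ∧
    -- the finite case, with `d = |N|` and `N = {l₁ > ⋯ > l_d}`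
    ((lyndonAtoms W).Finite →
      ∃ l : Fin (lyndonAtoms W).ncard → List X,
        StrictAnti l ∧ Set.range l = lyndonAtoms W ∧
        normalWords W = Set.range (fun k : Fin (lyndonAtoms W).ncard → ℕ => powProd l k) ∧
        LinearIndependent K
          (fun k : Fin (lyndonAtoms W).ncard → ℕ => wordClass K W (powProd l k)) ∧
        Submodule.span K
          (Set.range fun k : Fin (lyndonAtoms W).ncard → ℕ => wordClass K W (powProd l k)) = ⊤ ∧
        gkDim K (MonomialAlgebra K W) = ((lyndonAtoms W).ncard : EReal) ∧
        hilbertSeries (component K W) =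
          ∏ i, (1 - (PowerSeries.X : PowerSeries ℚ) ^ (l i).length)⁻¹) := by
  have h0 := nil_mem_normalWords hLyndon
  refine ⟨normalWords_eq hLyndon, ⟨linearIndependent_wordClass h0, span_wordClass_normalWords⟩,
    ?_, fun hfin => ?_⟩
  · tfae_have 1 → 2 := hasPolynomialGrowth_of_finite hLyndon
    tfae_have 2 → 1 := finite_of_hasPolynomialGrowth hLyndon
    tfae_have 1 → 4 := embedsInMatrixOverField_of_finite hLyndon hAntichain
    tfae_have 4 → 5 := embedsInMatrixOverCommRing_of_field
    tfae_have 5 → 3 := isPIAlgebra_of_embedsInMatrixOverCommRing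
    tfae_have 3 → 1 := finite_of_isPIAlgebra hLyndon
    tfae_finish
  · obtain ⟨l, hl, hr⟩ : ∃ l : Fin (lyndonAtoms W).ncard → List X, StrictAnti l ∧
        Set.range l = lyndonAtoms W := by
      obtain ⟨l, hl, hr⟩ := exists_strictAnti_range_eq hfin.toFinset
      rw [hfin.coe_toFinset] at hr
      rw [Set.ncard_eq_toFinset_card _ hfin]
      exact ⟨l, hl, hr⟩
    have hatom : ∀ i, l i ∈ lyndonAtoms W := fun i => hr ▸ ⟨i, rfl⟩
    have hN := normalWords_eq_range hLyndon hl hr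
    refine ⟨l, hl, hr, hN, ?_, ?_, gkDim_eq hLyndon hl hr, hilbertSeries_eq hLyndon hl hr⟩
    · exact (linearIndependent_wordClass h0).comp
        (fun k => (⟨powProd l k, powProd_mem_normalWords hLyndon hl hatom k⟩ : normalWords W))
        fun k k' h => powProd_injective hl (fun i => (hatom i).1) (Subtype.mk.inj h)
    · rw [← span_wordClass_normalWords (K := K) (W := W), hN, ← Set.range_comp]
      rfl
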